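/- Let $\mathbb F$ be a field of characteristic $p>3$, let $m\ge 3$ be an integer and let $\underline t=(t_1,\dots,t_m)$ be an $m$-tuple of positive integers. Let $\mathcal O(m,m;\underline t)=\mathcal O(m;\underline t)\otimes\Lambda(m)$, where $\mathcal O(m;\underline t)$ is the divided power algebra with basis $\{x^{(\alpha)}\mid 0\le \alpha_i\le p^{t_i}-1\}$ and product $x^{(\alpha)}x^{(\beta)}=\binom{\alpha+\beta}{\alpha}x^{(\alpha+\beta)}$ (read as $0$ if $\alpha+\beta$ is out of range), and $\Lambda(m)$ is the exterior algebra in odd variables $x_{m+1},\dots,x_{2m}$. Let $\partial_r$ ($1\le r\le 2m$) be the partial superderivations of $\mathcal O(m,m;\underline t)$, and let $W(m,m;\underline t)$ be the Lie superalgebra spanned by all $f\partial_r$, $f\in\mathcal O(m,m;\underline t)$, with the supercommutator of endomorphisms as bracket. Put $i'=i+m$ for $i\le m$ and $i'=i-m$ for $i>m$, write $\mathrm p(\cdot)$ for the parity, and let $$\mathrm{T_H}(a)=\sum_{i=1}^{2m}(-1)^{\mathrm p(\partial_i)\mathrm p(a)}\partial_i(a)\partial_{i'},\qquad \mathrm{div}(f_r\partial_r)=(-1)^{\mathrm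 p(\partial_r)\mathrm p(f_r)}\partial_r(f_r),$$ for homogeneous $a$, $f_r$, both extended linearly. Let $$SHO(m,m;\underline t)=\{D\in W(m,m;\underline t)\mid \mathrm{div}(D)=0\}\cap\{\mathrm{T_H}(a)\mid a\in\mathcal O(m,m;\underline t)\},$$ and let $SHO(m,m;\underline t)^{(1)}=[SHO(m,m;\underline t),SHO(m,m;\underline t)]$ and $SHO(m,m;\underline t)^{(2)}=[SHO(m,m;\underline t)^{(1)},SHO(m,m;\underline t)^{(1)}]$ be its derived algebras. A Lie superalgebra $L=L_{\bar0}\oplus L_{\bar1}$ over $\mathbb F$ is called restricted if there is a map $x\mapsto x^{[p]}$ from $L_{\bar 0}$ to itself with $(cx)^{[p]}=c^px^{[p]}$ and $(x+y)^{[p]}=x^{[p]}+y^{[p]}+\sum_{i=1}^{p-1}s_i(x,y)$ for $c\in\mathbb F$, $x,y\in L_{\bar0}$, where $i\,s_i(x,y)$ is the coefficient of $T^{i-1}$ in $(\mathrm{ad}(Tx+y))^{p-1}(x)$, and $\mathrm{ad}(x^{[p]})=(\mathrm{ad}\,x)^p$ on $L$ for all $x\in L_{\bar0}$. **Theorem.**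 The Lie superalgebra $SHO(m,m;\underline t)^{(2)}$ is restricted if and only if $\underline t=(1,\dots,1)$. -/

import Mathlib

/-! ### Superspaces and Lie superalgebras -/

/-- The sign `(-1)^(i j)` for parities `i, j`. -/
def koszul (i j : ZMod 2) : ℤ := if i = 1 ∧ j = 1 then -1 else 1

theorem koszul_comm (i j : ZMod 2) : koszul i j = koszul j i := by
  revert i j; decide

theorem koszul_mul_self (i j : ZMod 2) : koszul i j * koszul i j = 1 := by
  revert i j; decide

theorem koszul_add_left (i j k : ZMod 2) : koszul (i + j) k = koszul i k * koszul j k := by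
  revert i j k; decide

theorem koszul_add_right (i j k : ZMod 2) : koszul i (j + k) = koszul i j * koszul i k := by
  revert i j k; decide

/-- A vector superspace `V = V₀ ⊕ V₁`, the decomposition being given by the projections
`proj 0`, `proj 1` onto the two summands. -/
class SuperSpace (F V : Type*) [Field F] [AddCommGroup V] [Module F V] where
  proj : ZMod 2 → V →ₗ[F] V
  proj_proj : ∀ i j v, proj i (proj j v) = if i = j then proj j v else 0
  proj_add_proj : ∀ v, proj 0 v + proj 1 v = v

namespace SuperSpace

/-- The homogeneous part `V_i`. -/
def homog (F : Type*) {V : Type*} [Field F] [AddCommGroup V] [Module F V] [SuperSpace F V]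
    (i : ZMod 2) : Submodule F V :=
  LinearMap.range (proj (F := F) (V := V) i)

variable {F V : Type*} [Field F] [AddCommGroup V] [Module F V] [SuperSpace F V]

theorem mem_homog {i : ZMod 2} {v : V} : v ∈ homog F i ↔ proj (F := F) i v = v := by
  constructor
  · rintro ⟨w, rfl⟩
    simp [proj_proj]
  · intro h
    exact ⟨v, h⟩

theorem proj_mem (i : ZMod 2) (v : V) : proj (F := F) i v ∈ homog F i := ⟨v, rfl⟩

theorem proj_of_mem {i j : ZMod 2} {v : V} (h : v ∈ homog F j) :
    proj (F := F) i v = if i = j then v else 0 := by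
  rw [← mem_homog.1 h, proj_proj]

theorem sum_proj (v : V) : ∑ i : ZMod 2, proj (F := F) i v = v :=
  (Fin.sum_univ_two _).trans (proj_add_proj v)

end SuperSpace

/-- A Lie superalgebra over a field (of characteristic different from 2 and 3): a superspace with
a bilinear even bracket which is super skew-symmetric and satisfies the super Jacobi identity. -/
class LieSuperalgebra (F L : Type*) [Field F] [AddCommGroup L] [Module F L]
    [SuperSpace F L] where
  br : L →ₗ[F] L →ₗ[F] L
  br_mem : ∀ (i j : ZMod 2) (x y : L), x ∈ SuperSpace.homog F i → y ∈ SuperSpace.homog F j →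
    br x y ∈ SuperSpace.homog F (i + j)
  br_skew : ∀ (i j : ZMod 2) (x y : L), x ∈ SuperSpace.homog F i → y ∈ SuperSpace.homog F j →
    br x y = -(koszul i j • br y x)
  br_jacobi : ∀ (i j k : ZMod 2) (x y z : L), x ∈ SuperSpace.homog F i →
    y ∈ SuperSpace.homog F j → z ∈ SuperSpace.homog F k →
    br x (br y z) = br (br x y) z + koszul i j • br y (br x z)

namespace LieSuperalgebra

variable (F : Type*) {L : Type*} [Field F] [AddCommGroup L] [Module F L] [SuperSpace F L]
  [LieSuperalgebra F L]

/-- `adCoeff F x y n k` is the coefficient of `T ^ k` in `(ad (T x + y)) ^ n (x)`. -/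
def adCoeff (x y : L) : ℕ → ℕ → L
  | 0, 0 => x
  | 0, _ + 1 => 0
  | n + 1, 0 => br (F := F) y (adCoeff x y n 0)
  | n + 1, k + 1 => br (F := F) y (adCoeff x y n (k + 1)) + br (F := F) x (adCoeff x y n k)

/-- Jacobson's Lie polynomials `s_i(x, y)`, `1 ≤ i ≤ p - 1`: `i s_i(x, y)` is the coefficient of
`T ^ (i - 1)` in `(ad (T x + y)) ^ (p - 1) (x)`. -/
def jacobson (p : ℕ) (x y : L) (i : ℕ) : L := (i : F)⁻¹ • adCoeff F x y (p - 1) (i - 1)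

variable (L)

/-- `L` is restricted (over a field of characteristic `p`): the even part carries a `p`-mapping
`x ↦ x^[p]` making it a restricted Lie algebra, such that `ad (x^[p]) = (ad x)^p` on all of `L`
(so that the odd part is a restricted module as well). -/
def IsRestricted (p : ℕ) : Prop :=
  ∃ pm : SuperSpace.homog F (V := L) 0 → SuperSpace.homog F (V := L) 0,
    (∀ (x : SuperSpace.homog F (V := L) 0) (z : L),
      br (F := F) (pm x : L) z = (br (F := F) (x : L))^[p] z) ∧
    (∀ (c : F) (x : SuperSpace.homog F (V := L) 0), pm (c • x) = c ^ p • pm x) ∧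
    (∀ x y : SuperSpace.homog F (V := L) 0,
      (pm (x + y) : L) = pm x + pm y + ∑ i ∈ Finset.Icc 1 (p - 1), jacobson F p (x : L) (y : L) i)

end LieSuperalgebra

/-- A sub-superalgebra of a Lie superalgebra: a graded subspace closed under the bracket. -/
structure LieSubsuperalgebra (F L : Type*) [Field F] [AddCommGroup L] [Module F L]
    [SuperSpace F L] [LieSuperalgebra F L] where
  carrier : Submodule F L
  proj_mem : ∀ (i : ZMod 2) (x : L), x ∈ carrier → SuperSpace.proj (F := F) i x ∈ carrier
  br_mem : ∀ x y : L, x ∈ carrier → y ∈ carrier → LieSuperalgebra.br (F := F) x y ∈ carrier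

namespace LieSubsuperalgebra

variable {F L : Type*} [Field F] [AddCommGroup L] [Module F L] [SuperSpace F L]
  [LieSuperalgebra F L]

instance (K : LieSubsuperalgebra F L) : SuperSpace F K.carrier where
  proj i := (SuperSpace.proj (F := F) (V := L) i).restrict (K.proj_mem i)
  proj_proj i j v := by
    apply Subtype.ext
    have := SuperSpace.proj_proj (F := F) i j (v : L)
    by_cases h : i = j <;> simp_all
  proj_add_proj v := by
    apply Subtype.ext
    simpa using SuperSpace.proj_add_proj (F := F) (v : L)

theorem coe_mem_homog (K : LieSubsuperalgebra F L) {i : ZMod 2} {x : K.carrier} :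
    x ∈ SuperSpace.homog F i ↔ (x : L) ∈ SuperSpace.homog F i := by
  rw [SuperSpace.mem_homog, SuperSpace.mem_homog, Subtype.ext_iff]
  rfl

/-- A sub-superalgebra is a Lie superalgebra with the restricted grading and bracket. -/
instance (K : LieSubsuperalgebra F L) : LieSuperalgebra F K.carrier where
  br := LinearMap.mk₂ F
    (fun x y => ⟨LieSuperalgebra.br (F := F) (x : L) (y : L), K.br_mem _ _ x.2 y.2⟩)
    (fun _ _ _ => Subtype.ext (by simp)) (fun _ _ _ => Subtype.ext (by simp))
    (fun _ _ _ => Subtype.ext (by simp)) (fun _ _ _ => Subtype.ext (by simp))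
  br_mem i j x y hx hy :=
    K.coe_mem_homog.2 (LieSuperalgebra.br_mem i j _ _ (K.coe_mem_homog.1 hx) (K.coe_mem_homog.1 hy))
  br_skew i j x y hx hy := Subtype.ext
    (LieSuperalgebra.br_skew i j _ _ (K.coe_mem_homog.1 hx) (K.coe_mem_homog.1 hy))
  br_jacobi i j k x y z hx hy hz := Subtype.ext
    (LieSuperalgebra.br_jacobi i j k _ _ _ (K.coe_mem_homog.1 hx) (K.coe_mem_homog.1 hy)
      (K.coe_mem_homog.1 hz))

theorem proj_br (i : ZMod 2) (x y : L) :
    SuperSpace.proj (F := F) i (LieSuperalgebra.br (F := F) x y) =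
      ∑ j : ZMod 2, LieSuperalgebra.br (F := F)
        (SuperSpace.proj (F := F) j x) (SuperSpace.proj (F := F) (i - j) y) := by
  conv_lhs => rw [← SuperSpace.sum_proj (F := F) x, ← SuperSpace.sum_proj (F := F) y]
  simp only [map_sum, LinearMap.sum_apply]
  have key : ∀ j k : ZMod 2, SuperSpace.proj (F := F) i (LieSuperalgebra.br (F := F)
      (SuperSpace.proj (F := F) j x) (SuperSpace.proj (F := F) k y)) =
      if k = i - j then LieSuperalgebra.br (F := F)
        (SuperSpace.proj (F := F) j x) (SuperSpace.proj (F := F) k y) else 0 := by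
    intro j k
    rw [SuperSpace.proj_of_mem (LieSuperalgebra.br_mem j k _ _
      (SuperSpace.proj_mem _ _) (SuperSpace.proj_mem _ _))]
    have : i = j + k ↔ k = i - j := by revert i j k; decide
    simp only [this]
  simp only [key]
  rw [Finset.sum_comm]
  simp

/-- The derived algebra `[K, K]`, the span of all brackets. -/
def derived (K : LieSubsuperalgebra F L) : LieSubsuperalgebra F L where
  carrier := Submodule.span F
    {z | ∃ x ∈ K.carrier, ∃ y ∈ K.carrier, z = LieSuperalgebra.br (F := F) x y}
  proj_mem i z hz := by
    induction hz using Submodule.span_induction with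
    | zero => simp
    | add a b _ _ ha hb => rw [map_add]; exact Submodule.add_mem _ ha hb
    | smul c a _ ha => rw [map_smul]; exact Submodule.smul_mem _ c ha
    | mem a ha =>
      obtain ⟨x, hx, y, hy, rfl⟩ := ha
      rw [proj_br]
      exact Submodule.sum_mem _ fun j _ => Submodule.subset_span
        ⟨_, K.proj_mem _ _ hx, _, K.proj_mem _ _ hy, rfl⟩
  br_mem x y hx hy := by
    have hle : Submodule.span F
        {z | ∃ x ∈ K.carrier, ∃ y ∈ K.carrier, z = LieSuperalgebra.br (F := F) x y} ≤
        K.carrier := by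
      rw [Submodule.span_le]
      rintro _ ⟨a, ha, b, hb, rfl⟩
      exact K.br_mem _ _ ha hb
    exact Submodule.subset_span ⟨x, hle hx, y, hle hy, rfl⟩

end LieSubsuperalgebra

/-! ### The general linear Lie superalgebra of a superspace -/

namespace SuperEnd

open SuperSpace

variable {F V : Type*} [Field F] [AddCommGroup V] [Module F V] [SuperSpace F V]

/-- The endomorphisms of parity `i` are those that map `V_j` into `V_(j+i)` for all `j`
(see `mem_homog_iff` below). -/
instance : SuperSpace F (Module.End F V) where
  proj i :=
    { toFun := fun D => ∑ j : ZMod 2, proj (F := F) (j + i) * D * proj (F := F) j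
      map_add' := fun D E => by simp only [mul_add, add_mul, Finset.sum_add_distrib]
      map_smul' := fun c D => by
        simp only [mul_smul_comm, smul_mul_assoc, Finset.smul_sum, RingHom.id_apply] }
  proj_proj i j D := by
    have hs : ∀ f : ZMod 2 → Module.End F V, ∑ k, f k = f 0 + f 1 := fun f => Fin.sum_univ_two f
    have h1 : (1 : ZMod 2) + 1 = 0 := by decide
    have hz : ∀ a : ZMod 2, a = 0 ∨ a = 1 := by decide
    ext v
    rcases hz i with rfl | rfl <;> rcases hz j with rfl | rfl <;>
      simp [hs, h1, proj_proj]
  proj_add_proj D := by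
    have hs : ∀ f : ZMod 2 → Module.End F V, ∑ k, f k = f 0 + f 1 := fun f => Fin.sum_univ_two f
    have h1 : (1 : ZMod 2) + 1 = 0 := by decide
    ext v
    have e1 := proj_add_proj (F := F) (D (proj (F := F) 0 v))
    have e2 := proj_add_proj (F := F) (D (proj (F := F) 1 v))
    have e3 := congrArg D (proj_add_proj (F := F) v)
    rw [map_add] at e3
    simp only [LinearMap.coe_mk, AddHom.coe_mk, hs, h1, LinearMap.add_apply, Module.End.mul_apply,
      zero_add, add_zero]
    conv_rhs => rw [← e3, ← e1, ← e2]
    abel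

theorem proj_apply (i : ZMod 2) (D : Module.End F V) (v : V) :
    proj (F := F) i D v = ∑ j : ZMod 2, proj (F := F) (j + i) (D (proj (F := F) j v)) := by
  change (∑ j : ZMod 2, proj (F := F) (j + i) * D * proj (F := F) j : Module.End F V) v = _
  simp

theorem mem_homog_iff {i : ZMod 2} {D : Module.End F V} :
    D ∈ homog F i ↔ ∀ (j : ZMod 2) (v : V), v ∈ homog F j → D v ∈ homog F (j + i) := by
  constructor
  · intro h j v hv
    rw [← mem_homog.1 h, proj_apply]
    refine Submodule.sum_mem _ fun k _ => ?_
    rw [proj_of_mem hv]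
    split_ifs with hk
    · subst hk; exact proj_mem _ _
    · simp
  · intro h
    rw [mem_homog]
    ext v
    rw [proj_apply]
    conv_rhs => rw [← sum_proj (F := F) v, map_sum]
    exact Finset.sum_congr rfl fun j _ => mem_homog.1 (h j _ (proj_mem _ _))

theorem mul_mem {i j : ZMod 2} {D E : Module.End F V} (hD : D ∈ homog F i) (hE : E ∈ homog F j) :
    D * E ∈ homog F (i + j) := by
  rw [mem_homog_iff] at *
  intro k v hv
  have := hD _ _ (hE k v hv)
  rwa [add_assoc, add_comm j i] at this

/-- The bilinear extension of `[D, E] = D E - (-1)^(|D||E|) E D`. -/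
def bracket : Module.End F V →ₗ[F] Module.End F V →ₗ[F] Module.End F V :=
  LinearMap.mk₂ F
    (fun D E => ∑ i : ZMod 2, ∑ j : ZMod 2,
      (proj (F := F) i D * proj (F := F) j E -
        koszul i j • (proj (F := F) j E * proj (F := F) i D)))
    (fun a b c => by
      simp only [map_add, mul_add, add_mul, smul_add, ← Finset.sum_add_distrib]
      exact Finset.sum_congr rfl fun i _ => Finset.sum_congr rfl fun j _ => by abel)
    (fun c a b => by
      simp only [map_smul, mul_smul_comm, smul_mul_assoc, Finset.smul_sum, smul_sub]
      exact Finset.sum_congr rfl fun i _ => Finset.sum_congr rfl fun j _ => by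
        rw [smul_comm c (koszul i j)])
    (fun a b c => by
      simp only [map_add, mul_add, add_mul, smul_add, ← Finset.sum_add_distrib]
      exact Finset.sum_congr rfl fun i _ => Finset.sum_congr rfl fun j _ => by abel)
    (fun c a b => by
      simp only [map_smul, mul_smul_comm, smul_mul_assoc, Finset.smul_sum, smul_sub]
      exact Finset.sum_congr rfl fun i _ => Finset.sum_congr rfl fun j _ => by
        rw [smul_comm c (koszul i j)])

theorem bracket_eq (D E : Module.End F V) :
    bracket D E = ∑ i : ZMod 2, ∑ j : ZMod 2,
      (proj (F := F) i D * proj (F := F) j E -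
        koszul i j • (proj (F := F) j E * proj (F := F) i D)) := rfl

theorem bracket_of_mem {i j : ZMod 2} {D E : Module.End F V} (hD : D ∈ homog F i)
    (hE : E ∈ homog F j) : bracket D E = D * E - koszul i j • (E * D) := by
  rw [bracket_eq, Finset.sum_eq_single i, Finset.sum_eq_single j]
  · rw [mem_homog.1 hD, mem_homog.1 hE]
  · intro k _ hk
    rw [proj_of_mem hE, if_neg hk]
    simp
  · simp
  · intro k _ hk
    rw [proj_of_mem hD, if_neg hk]
    simp
  · simp

theorem bracket_mem {i j : ZMod 2} {D E : Module.End F V} (hD : D ∈ homog F i)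
    (hE : E ∈ homog F j) : bracket D E ∈ homog F (i + j) := by
  rw [bracket_of_mem hD hE]
  refine Submodule.sub_mem _ (mul_mem hD hE) (zsmul_mem ?_ _)
  rw [add_comm]
  exact mul_mem hE hD

/-- The general linear Lie superalgebra `gl(V)`. -/
instance : LieSuperalgebra F (Module.End F V) where
  br := bracket
  br_mem _ _ _ _ := bracket_mem
  br_skew i j x y hx hy := by
    rw [bracket_of_mem hx hy, bracket_of_mem hy hx]
    rw [koszul_comm j i, smul_sub, smul_smul, koszul_mul_self, one_smul]
    abel
  br_jacobi i j k x y z hx hy hz := by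
    rw [bracket_of_mem hx (bracket_mem hy hz), bracket_of_mem (bracket_mem hx hy) hz,
      bracket_of_mem hy (bracket_mem hx hz), bracket_of_mem hx hy, bracket_of_mem hx hz,
      bracket_of_mem hy hz]
    rw [koszul_add_right i j k, koszul_add_left i j k, koszul_add_right j i k, koszul_comm j i]
    have h2 := koszul_mul_self i j
    generalize koszul i j = a at *
    generalize koszul i k = b at *
    generalize koszul j k = c at *
    simp only [mul_sub, sub_mul, smul_sub, mul_smul_comm, smul_mul_assoc, smul_smul, mul_assoc]
    have e4 : a * (a * c) = c := by rw [← mul_assoc, h2, one_mul]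
    have e5 : b * (c * a) = a * (b * c) := by ring
    have e6 : a * (a * (c * b)) = b * c := by rw [← mul_assoc, h2, one_mul, mul_comm]
    rw [e4, e5, e6]
    abel

end SuperEnd

/-! ### The special odd Hamiltonian superalgebras -/

namespace OddHam

open SuperSpace

/-- The multi-indices `α` with `α i ≤ p ^ (t i) - 1`. -/
abbrev Box (p : ℕ) {m : ℕ} (t : Fin m → ℕ+) : Type :=
  {α : Fin m → ℕ // ∀ i, α i < p ^ (t i : ℕ)}

/-- The indices `1, …, 2 m` of the variables: `inl i` is the even variable `x_i` and `inr i` is the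
odd variable `x_{i'}`, so that `Sum.swap` is the involution `r ↦ r'`. -/
abbrev Y (m : ℕ) : Type := Fin m ⊕ Fin m

/-- The parity of the variable `x_r`, and of `∂_r`. -/
def parity {m : ℕ} : Y m → ZMod 2
  | Sum.inl _ => 0
  | Sum.inr _ => 1

/-- The number of transpositions that sort the product `x^u x^v`. -/
def inv {m : ℕ} (u v : Finset (Fin m)) : ℕ := ((u ×ˢ v).filter fun x => x.2 < x.1).card

noncomputable section

variable {F : Type*} [Field F] {p m : ℕ} {t : Fin m → ℕ+}

/-- The superspace `O(m, m; t)`, tensor product of the divided power algebra `O(m; t)` and the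
exterior algebra in `m` odd variables, through its standard basis `x^(α) x^u`. A subset `u` of
`Fin m` stands for the increasing product of the odd variables `x_{i'}`, `i ∈ u`. -/
def O (F : Type*) [Field F] (p : ℕ) {m : ℕ} (t : Fin m → ℕ+) : Type _ :=
  (Box p t × Finset (Fin m)) →₀ F

instance : AddCommGroup (O F p t) :=
  inferInstanceAs (AddCommGroup ((Box p t × Finset (Fin m)) →₀ F))

instance : Module F (O F p t) :=
  inferInstanceAs (Module F ((Box p t × Finset (Fin m)) →₀ F))

/-- The standard basis of `O(m, m; t)`. -/
def bas (a : Box p t × Finset (Fin m)) : O F p t := Finsupp.single a (1 : F)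

/-- The linear map with prescribed values on the standard basis. -/
def lift {M : Type*} [AddCommGroup M] [Module F M] (g : Box p t × Finset (Fin m) → M) :
    O F p t →ₗ[F] M :=
  Finsupp.linearCombination F g

@[simp] theorem lift_bas {M : Type*} [AddCommGroup M] [Module F M]
    (g : Box p t × Finset (Fin m) → M) (a : Box p t × Finset (Fin m)) :
    lift (F := F) g (bas a) = g a :=
  (Finsupp.linearCombination_single F (1 : F) a).trans (one_smul F _)

theorem bas_induction {P : O F p t → Prop} (h0 : P 0) (hadd : ∀ f g, P f → P g → P (f + g))
    (hm : ∀ (c : F) (a : Box p t × Finset (Fin m)), P (c • bas a)) (f : O F p t) : P f := by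
  refine Finsupp.induction_linear (motive := P) f h0 hadd fun a c => ?_
  have h : (c • bas a : O F p t) = Finsupp.single a c :=
    (Finsupp.smul_single c a (1 : F)).trans (by rw [smul_eq_mul, mul_one])
  have := hm c a
  rwa [h] at this

/-- The basis element `x^(α) x^u`, read as `0` if `α` is out of range. -/
def mono (α : Fin m → ℕ) (u : Finset (Fin m)) : O F p t :=
  if h : ∀ i, α i < p ^ (t i : ℕ) then bas (⟨α, h⟩, u) else 0

/-- The product of `O(m, m; t)`: `x^(α) x^u · x^(β) x^v` is `± binom(α + β, α) x^(α+β) x^(u ∪ v)`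
for disjoint `u`, `v`, and `0` otherwise. -/
def mul : O F p t →ₗ[F] O F p t →ₗ[F] O F p t :=
  lift fun a : Box p t × Finset (Fin m) =>
    lift fun b : Box p t × Finset (Fin m) =>
      if Disjoint a.2 b.2 then
        ((-1 : F) ^ inv a.2 b.2 * ((∏ i, (a.1.1 i + b.1.1 i).choose (a.1.1 i) : ℕ) : F)) •
          mono (a.1.1 + b.1.1) (a.2 ∪ b.2)
      else 0

/-- The `ℤ/2`-grading of `O(m, m; t)` by the parity of the number of odd variables. -/
instance : SuperSpace F (O F p t) where
  proj i := lift fun a : Box p t × Finset (Fin m) =>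
    if (a.2.card : ZMod 2) = i then bas a else 0
  proj_proj i j v := by
    induction v using bas_induction with
    | h0 => simp
    | hadd f g hf hg => simp only [map_add, hf, hg]; split_ifs <;> simp
    | hm c a =>
      by_cases h : i = j
      · subst h
        by_cases h2 : (a.2.card : ZMod 2) = i <;> simp [h2]
      · by_cases h2 : (a.2.card : ZMod 2) = j
        · have h3 : (a.2.card : ZMod 2) ≠ i := fun h4 => h (h4.symm.trans h2)
          have h4 : j ≠ i := fun h5 => h h5.symm
          simp [h, h2, h4]
        · simp [h2]
  proj_add_proj v := by
    induction v using bas_induction with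
    | h0 => simp
    | hadd f g hf hg =>
      rw [map_add, map_add, add_add_add_comm, hf, hg]
    | hm c a =>
      have hz : ∀ i : ZMod 2, i = 0 ∨ i = 1 := by decide
      rcases hz (a.2.card : ZMod 2) with h | h <;> simp [h]

/-- The linear map `f ↦ (-1)^(i |f|) f`. -/
def twist (i : ZMod 2) : O F p t →ₗ[F] O F p t := ∑ j : ZMod 2, koszul i j • proj (F := F) j

/-- The partial (super)derivations `∂_r`. -/
def pd (r : Y m) : Module.End F (O F p t) :=
  lift fun a : Box p t × Finset (Fin m) =>
    match r with
    | Sum.inl i => if a.1.1 i = 0 then 0 else mono (a.1.1 - Pi.single i 1) a.2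
    | Sum.inr i =>
      if i ∈ a.2 then (-1 : F) ^ (a.2.filter fun j => j < i).card • mono a.1.1 (a.2.erase i) else 0

/-- The variables `x_r`. -/
def var : Y m → O F p t
  | Sum.inl i => mono (Pi.single i 1) ∅
  | Sum.inr i => mono 0 {i}

variable (F p t) in
/-- The generalized Witt superalgebra, spanned by the operators `f ∂_r`. -/
def W : Submodule F (Module.End F (O F p t)) :=
  Submodule.span F {D | ∃ (f : O F p t) (r : Y m), D = mul f * pd r}

/-- `T_H(a) = ∑_r (-1)^(|∂_r| |a|) ∂_r(a) ∂_{r'}`. -/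
def T : O F p t →ₗ[F] Module.End F (O F p t) where
  toFun a := ∑ r : Y m, mul (pd r (twist (parity r) a)) * pd r.swap
  map_add' a b := by simp only [map_add, add_mul, Finset.sum_add_distrib]
  map_smul' c a := by simp only [map_smul, smul_mul_assoc, Finset.smul_sum, RingHom.id_apply]

/-- The divergence. An element of `W` is `D = ∑ f_r ∂_r` with `f_r = D(x_r)`, and
`div(f_r ∂_r) = (-1)^(|∂_r| |f_r|) ∂_r(f_r)`; see `div_mul_pd` below. -/
def div : Module.End F (O F p t) →ₗ[F] O F p t where
  toFun D := ∑ r : Y m, pd r (twist (parity r) (D (var r)))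
  map_add' D E := by simp only [LinearMap.add_apply, map_add, Finset.sum_add_distrib]
  map_smul' c D := by
    simp only [LinearMap.smul_apply, map_smul, Finset.smul_sum, RingHom.id_apply]

variable (F p t) in
/-- The odd Hamiltonian superalgebra. -/
def HO : Submodule F (Module.End F (O F p t)) := LinearMap.range T

variable (F p t) in
/-- The subspace `S'` of divergence-free elements of `W`. -/
def S' : Submodule F (Module.End F (O F p t)) := W F p t ⊓ LinearMap.ker div

/-! The rest of the section shows that `S' ∩ HO` is a sub-superalgebra of `gl(O(m, m; t))`. -/

theorem mono_of_lt {α : Fin m → ℕ} (h : ∀ i, α i < p ^ (t i : ℕ)) (u : Finset (Fin m)) :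
    (mono α u : O F p t) = bas (⟨α, h⟩, u) := dif_pos h

theorem mono_of_not_lt {α : Fin m → ℕ} (h : ¬ ∀ i, α i < p ^ (t i : ℕ)) (u : Finset (Fin m)) :
    (mono α u : O F p t) = 0 := dif_neg h

theorem mono_induction {P : O F p t → Prop} (h0 : P 0) (hadd : ∀ f g, P f → P g → P (f + g))
    (hm : ∀ (c : F) (α : Fin m → ℕ) (_ : ∀ i, α i < p ^ (t i : ℕ)) (u : Finset (Fin m)),
      P (c • mono α u)) (f : O F p t) : P f := by
  induction f using bas_induction with
  | h0 => exact h0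
  | hadd f g hf hg => exact hadd f g hf hg
  | hm c a =>
    have := hm c a.1.1 a.1.2 a.2
    rwa [mono_of_lt a.1.2] at this

theorem mul_mono (α β : Fin m → ℕ) (u v : Finset (Fin m)) :
    mul (mono α u : O F p t) (mono β v) = if Disjoint u v then
      ((-1 : F) ^ inv u v * ((∏ i, (α i + β i).choose (α i) : ℕ) : F)) • mono (α + β) (u ∪ v)
      else 0 := by
  by_cases hα : ∀ i, α i < p ^ (t i : ℕ)
  · by_cases hβ : ∀ i, β i < p ^ (t i : ℕ)
    · rw [mono_of_lt hα, mono_of_lt hβ, mul]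
      simp
    · have : ¬ ∀ i, (α + β) i < p ^ (t i : ℕ) := fun h => hβ fun i =>
        lt_of_le_of_lt (Nat.le_add_left _ _) (h i)
      simp [mono_of_not_lt hβ, mono_of_not_lt this]
  · have : ¬ ∀ i, (α + β) i < p ^ (t i : ℕ) := fun h => hα fun i =>
      lt_of_le_of_lt (Nat.le_add_right _ _) (h i)
    simp [mono_of_not_lt hα, mono_of_not_lt this]

theorem proj_mono (i : ZMod 2) (α : Fin m → ℕ) (u : Finset (Fin m)) :
    proj (F := F) i (mono α u : O F p t) = if (u.card : ZMod 2) = i then mono α u else 0 := by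
  by_cases hα : ∀ i, α i < p ^ (t i : ℕ)
  · rw [mono_of_lt hα]
    exact lift_bas _ _
  · simp [mono_of_not_lt hα]

theorem mono_mem (α : Fin m → ℕ) (u : Finset (Fin m)) :
    (mono α u : O F p t) ∈ homog F (u.card : ZMod 2) := by
  rw [mem_homog, proj_mono, if_pos rfl]

theorem pd_inl_mono {α : Fin m → ℕ} (h : ∀ i, α i < p ^ (t i : ℕ)) (r : Fin m)
    (u : Finset (Fin m)) : pd (Sum.inl r) (mono α u : O F p t) =
      if α r = 0 then 0 else mono (α - Pi.single r 1) u := by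
  rw [mono_of_lt h, pd]
  simp

theorem pd_inr_mono (α : Fin m → ℕ) (r : Fin m) (u : Finset (Fin m)) :
    pd (Sum.inr r) (mono α u : O F p t) =
      if r ∈ u then (-1 : F) ^ (u.filter fun j => j < r).card • mono α (u.erase r) else 0 := by
  by_cases h : ∀ i, α i < p ^ (t i : ℕ)
  · rw [mono_of_lt h, pd]
    simp
  · simp [mono_of_not_lt h]

theorem inv_union_left {u v : Finset (Fin m)} (h : Disjoint u v) (w : Finset (Fin m)) :
    inv (u ∪ v) w = inv u w + inv v w := by
  unfold inv
  rw [Finset.union_product, Finset.filter_union, Finset.card_union_of_disjoint]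
  exact Finset.disjoint_filter_filter (Finset.disjoint_product.2 (Or.inl h))

theorem inv_union_right {v w : Finset (Fin m)} (h : Disjoint v w) (u : Finset (Fin m)) :
    inv u (v ∪ w) = inv u v + inv u w := by
  unfold inv
  rw [Finset.product_union, Finset.filter_union, Finset.card_union_of_disjoint]
  exact Finset.disjoint_filter_filter (Finset.disjoint_product.2 (Or.inr h))

theorem inv_singleton_left (r : Fin m) (v : Finset (Fin m)) :
    inv {r} v = (v.filter fun j => j < r).card := by
  unfold inv
  rw [Finset.singleton_product, Finset.filter_map, Finset.card_map]
  rfl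

theorem inv_singleton_right (r : Fin m) (u : Finset (Fin m)) :
    inv u {r} = (u.filter fun j => r < j).card := by
  unfold inv
  rw [Finset.product_singleton, Finset.filter_map, Finset.card_map]
  rfl

theorem inv_add_inv {u v : Finset (Fin m)} (h : Disjoint u v) :
    inv u v + inv v u = u.card * v.card := by
  have h1 : inv v u = ((u ×ˢ v).filter fun x => ¬ x.2 < x.1).card := by
    unfold inv
    refine Finset.card_bij (fun x _ => (x.2, x.1)) ?_ ?_ ?_
    · rintro ⟨a, b⟩ hx
      simp only [Finset.mem_filter, Finset.mem_product] at hx ⊢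
      exact ⟨⟨hx.1.2, hx.1.1⟩, not_lt.2 hx.2.le⟩
    · rintro ⟨a, b⟩ _ ⟨c, d⟩ _ h
      simp only [Prod.mk.injEq] at h ⊢
      exact ⟨h.2, h.1⟩
    · rintro ⟨a, b⟩ hx
      simp only [Finset.mem_filter, Finset.mem_product, not_lt] at hx
      refine ⟨(b, a), ?_, rfl⟩
      simp only [Finset.mem_filter, Finset.mem_product]
      refine ⟨⟨hx.1.2, hx.1.1⟩, lt_of_le_of_ne hx.2 ?_⟩
      rintro rfl
      exact Finset.disjoint_left.1 h hx.1.1 hx.1.2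
  rw [h1]
  unfold inv
  rw [Finset.card_filter_add_card_filter_not, Finset.card_product]

theorem mul_assoc' (f g h : O F p t) : mul (mul f g) h = mul f (mul g h) := by
  induction f using mono_induction with
  | h0 => simp
  | hadd a b ha hb => simp only [map_add, LinearMap.add_apply, ha, hb]
  | hm c α _ u =>
  induction g using mono_induction with
  | h0 => simp
  | hadd a b ha hb => simp only [map_add, LinearMap.add_apply, ha, hb]
  | hm d β _ v =>
  induction h using mono_induction with
  | h0 => simp
  | hadd a b ha hb => simp only [map_add, ha, hb]
  | hm e γ _ w =>
  simp only [map_smul, LinearMap.smul_apply]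
  congr 3
  rw [mul_mono, mul_mono]
  by_cases huv : Disjoint u v
  · by_cases hvw : Disjoint v w
    · simp only [huv, hvw, if_true, map_smul, LinearMap.smul_apply, mul_mono]
      by_cases huw : Disjoint u w
      · rw [if_pos (Finset.disjoint_union_left.2 ⟨huw, hvw⟩),
          if_pos (Finset.disjoint_union_right.2 ⟨huv, huw⟩), smul_smul, smul_smul, add_assoc,
          Finset.union_assoc, inv_union_left huv, inv_union_right hvw]
        congr 1
        have key : (∏ i, (α i + β i).choose (α i)) * ∏ i, ((α + β) i + γ i).choose ((α + β) i) =
            (∏ i, (β i + γ i).choose (β i)) * ∏ i, (α i + (β + γ) i).choose (α i) := by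
          rw [← Finset.prod_mul_distrib, ← Finset.prod_mul_distrib]
          refine Finset.prod_congr rfl fun i _ => ?_
          have := Nat.choose_mul (n := α i + β i + γ i) (k := α i + β i) (s := α i)
            (Nat.le_add_right _ _)
          rw [show α i + β i + γ i - α i = β i + γ i by omega,
            show α i + β i - α i = β i by omega] at this
          simp only [Pi.add_apply]
          rw [mul_comm, this, mul_comm, add_assoc]
        have key2 := congrArg (Nat.cast (R := F)) key
        rw [Nat.cast_mul, Nat.cast_mul] at key2
        rw [pow_add, pow_add]
        linear_combination ((-1 : F) ^ inv u v * (-1) ^ inv u w * (-1) ^ inv v w) * key2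
      · rw [if_neg fun h => huw (Finset.disjoint_union_left.1 h).1,
          if_neg fun h => huw (Finset.disjoint_union_right.1 h).2]
        simp
    · simp only [huv, hvw, if_true, if_false, map_smul, LinearMap.smul_apply, mul_mono, map_zero]
      rw [if_neg fun h => hvw (Finset.disjoint_union_left.1 h).2]
      simp
  · by_cases hvw : Disjoint v w
    · simp only [huv, hvw, if_true, if_false, map_smul, mul_mono, map_zero, LinearMap.zero_apply]
      rw [if_neg fun h => huv (Finset.disjoint_union_right.1 h).1]
      simp
    · simp [huv, hvw]

theorem koszul_card (a b : ℕ) : ((koszul (a : ZMod 2) (b : ZMod 2) : ℤ) : F) = (-1) ^ (a * b) := by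
  have h1 : ∀ n : ℕ, (n : ZMod 2) = 1 ↔ Odd n := fun n => by
    rw [← ZMod.natCast_eq_one_iff_odd]
  unfold koszul
  by_cases h : Odd a ∧ Odd b
  · rw [if_pos ⟨(h1 a).2 h.1, (h1 b).2 h.2⟩, (Nat.odd_mul.2 h).neg_one_pow]
    simp
  · rw [if_neg fun h' => h ⟨(h1 a).1 h'.1, (h1 b).1 h'.2⟩, Even.neg_one_pow]
    · simp
    · rwa [← Nat.not_odd_iff_even, Nat.odd_mul]

theorem homog_induction {i : ZMod 2} {P : O F p t → Prop} (h0 : P 0)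
    (hadd : ∀ f g, P f → P g → P (f + g))
    (hm : ∀ (c : F) (α : Fin m → ℕ) (_ : ∀ i, α i < p ^ (t i : ℕ)) (u : Finset (Fin m)),
      (u.card : ZMod 2) = i → P (c • mono α u)) {f : O F p t} (hf : f ∈ homog F i) : P f := by
  rw [← mem_homog.1 hf]
  clear hf
  induction f using mono_induction with
  | h0 => simpa using h0
  | hadd a b ha hb => rw [map_add]; exact hadd _ _ ha hb
  | hm c α hα u =>
    rw [map_smul, proj_mono]
    split_ifs with h
    · exact hm c α hα u h
    · simpa using h0

theorem mul_mem {i j : ZMod 2} {f g : O F p t} (hf : f ∈ homog F i) (hg : g ∈ homog F j) :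
    mul f g ∈ homog F (i + j) := by
  refine homog_induction (P := fun f => mul f g ∈ homog F (i + j)) (by simp)
    (fun a b ha hb => by rw [map_add]; exact Submodule.add_mem _ ha hb) ?_ hf
  intro c α _ u hu
  refine homog_induction (P := fun g => mul (c • mono α u) g ∈ homog F (i + j)) (by simp)
    (fun a b ha hb => by rw [map_add]; exact Submodule.add_mem _ ha hb) ?_ hg
  intro d β _ v hv
  rw [map_smul, map_smul, LinearMap.smul_apply, mul_mono]
  refine Submodule.smul_mem _ _ (Submodule.smul_mem _ _ ?_)
  split_ifs with h
  · refine Submodule.smul_mem _ _ ?_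
    have := mono_mem (F := F) (p := p) (t := t) (α + β) (u ∪ v)
    rwa [Finset.card_union_of_disjoint h, Nat.cast_add, hu, hv] at this
  · simp

theorem mul_comm' {i j : ZMod 2} {f g : O F p t} (hf : f ∈ homog F i) (hg : g ∈ homog F j) :
    mul f g = koszul i j • mul g f := by
  refine homog_induction (P := fun f => mul f g = koszul i j • mul g f) (by simp)
    (fun a b ha hb => by simp only [map_add, LinearMap.add_apply, ha, hb, smul_add]) ?_ hf
  intro c α _ u hu
  refine homog_induction
    (P := fun g => mul (c • mono α u) g = koszul i j • mul g (c • mono α u)) (by simp)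
    (fun a b ha hb => by simp only [map_add, LinearMap.add_apply, ha, hb, smul_add]) ?_ hg
  intro d β _ v hv
  simp only [map_smul, LinearMap.smul_apply, mul_mono]
  by_cases h : Disjoint u v
  · rw [if_pos h, if_pos h.symm, ← Int.cast_smul_eq_zsmul F, ← hu, ← hv, koszul_card,
      ← inv_add_inv h, add_comm β α, Finset.union_comm v u]
    have e : ∀ i, (β i + α i).choose (β i) = (α i + β i).choose (α i) := fun i => by
      rw [add_comm, Nat.choose_symm_add]
    simp only [e, smul_smul, pow_add]
    congr 1
    have h2 : ((-1 : F) ^ inv v u) * (-1) ^ inv v u = 1 := by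
      rw [← mul_pow]; simp
    linear_combination (-(c * d * (-1 : F) ^ inv u v *
      ((∏ i, (α i + β i).choose (α i) : ℕ) : F))) * h2
  · rw [if_neg h, if_neg fun h' => h h'.symm]
    simp

theorem twist_of_mem {i j : ZMod 2} {f : O F p t} (hf : f ∈ homog F j) :
    twist i f = koszul i j • f := by
  unfold twist
  rw [LinearMap.sum_apply, Finset.sum_eq_single j]
  · rw [LinearMap.smul_apply, mem_homog.1 hf]
  · intro k _ hk
    rw [LinearMap.smul_apply, proj_of_mem hf, if_neg hk, smul_zero]
  · simp

theorem pd_mem (r : Y m) : (pd r : Module.End F (O F p t)) ∈ homog F (parity r) := by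
  rw [SuperEnd.mem_homog_iff]
  intro j f hf
  refine homog_induction (P := fun f => pd r f ∈ homog F (j + parity r)) (by simp)
    (fun a b ha hb => by rw [map_add]; exact Submodule.add_mem _ ha hb) ?_ hf
  intro c α hα u hu
  rw [map_smul]
  refine Submodule.smul_mem _ _ ?_
  rcases r with r | r
  · rw [pd_inl_mono hα]
    split_ifs
    · simp
    · simpa [parity, hu] using mono_mem (F := F) (p := p) (t := t) (α - Pi.single r 1) u
  · rw [pd_inr_mono]
    split_ifs with h
    · refine Submodule.smul_mem _ _ ?_
      have := mono_mem (F := F) (p := p) (t := t) α (u.erase r)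
      have h2 : ((u.erase r).card : ZMod 2) = j + 1 := by
        rw [← hu, ← Finset.card_erase_add_one h, Nat.cast_add, Nat.cast_one, add_assoc,
          show (1 : ZMod 2) + 1 = 0 by decide, add_zero]
      rwa [h2] at this
    · simp

theorem apply_mem {i j : ZMod 2} {D : Module.End F (O F p t)} (hD : D ∈ homog F i) {f : O F p t}
    (hf : f ∈ homog F j) : D f ∈ homog F (j + i) := by
  rw [SuperEnd.mem_homog_iff] at hD
  exact hD j f hf

theorem pd_zsmul (r : Y m) (n : ℤ) (f : O F p t) : pd r (n • f) = n • pd r f := map_zsmul _ _ _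

theorem mul_zsmul (f : O F p t) (n : ℤ) (g : O F p t) : mul f (n • g) = n • mul f g :=
  map_zsmul _ _ _

theorem zsmul_mul (f : O F p t) (n : ℤ) (g : O F p t) : mul (n • f) g = n • mul f g := by
  rw [map_zsmul, LinearMap.smul_apply]

theorem pd_inl_mul [Fact p.Prime] [CharP F p] (r : Fin m) (f g : O F p t) :
    pd (Sum.inl r) (mul f g) = mul (pd (Sum.inl r) f) g + mul f (pd (Sum.inl r) g) := by
  induction f using mono_induction with
  | h0 => simp
  | hadd a b ha hb => simp only [map_add, LinearMap.add_apply, ha, hb]; abel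
  | hm c α hα u =>
  induction g using mono_induction with
  | h0 => simp
  | hadd a b ha hb => simp only [map_add, ha, hb]; abel
  | hm d β hβ v =>
  simp only [map_smul, LinearMap.smul_apply, ← smul_add]
  congr 2
  rw [pd_inl_mono hα, pd_inl_mono hβ, mul_mono]
  by_cases huv : Disjoint u v
  swap
  · split_ifs <;> simp [mul_mono, huv]
  rw [if_pos huv, map_smul]
  set C : ℕ := ∏ i ∈ Finset.univ.erase r, (α i + β i).choose (α i) with hC
  have hprod : ∏ i, (α i + β i).choose (α i) = (α r + β r).choose (α r) * C :=
    (Finset.mul_prod_erase _ _ (Finset.mem_univ r)).symm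
  have hl : mul (if α r = 0 then 0 else mono (α - Pi.single r 1) u : O F p t) (mono β v) =
      if α r = 0 then 0 else ((-1 : F) ^ inv u v *
        (((α r - 1 + β r).choose (α r - 1) * C : ℕ) : F)) •
        mono (α + β - Pi.single r 1) (u ∪ v) := by
    split_ifs with h
    · simp
    · rw [mul_mono, if_pos huv, ← Finset.mul_prod_erase _ _ (Finset.mem_univ r)]
      refine congrArg₂ (fun (a : F) (f : O F p t) => ((-1 : F) ^ inv u v * a) • f) ?_
        (congrArg (fun γ => (mono γ (u ∪ v) : O F p t)) ?_)
      · refine congrArg (Nat.cast (R := F)) (congrArg₂ (· * ·) ?_ ?_)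
        · simp
        · refine Finset.prod_congr rfl fun i hi => ?_
          simp [Pi.single_eq_of_ne (Finset.ne_of_mem_erase hi)]
      · ext i
        by_cases hi : i = r
        · subst hi; simp; omega
        · simp [Pi.single_eq_of_ne hi]
  have hr : mul (mono α u) (if β r = 0 then 0 else mono (β - Pi.single r 1) v : O F p t) =
      if β r = 0 then 0 else ((-1 : F) ^ inv u v *
        (((α r + (β r - 1)).choose (α r) * C : ℕ) : F)) •
        mono (α + β - Pi.single r 1) (u ∪ v) := by
    split_ifs with h
    · simp
    · rw [mul_mono, if_pos huv, ← Finset.mul_prod_erase _ _ (Finset.mem_univ r)]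
      refine congrArg₂ (fun (a : F) (f : O F p t) => ((-1 : F) ^ inv u v * a) • f) ?_
        (congrArg (fun γ => (mono γ (u ∪ v) : O F p t)) ?_)
      · refine congrArg (Nat.cast (R := F)) (congrArg₂ (· * ·) ?_ ?_)
        · simp
        · refine Finset.prod_congr rfl fun i hi => ?_
          simp [Pi.single_eq_of_ne (Finset.ne_of_mem_erase hi)]
      · ext i
        by_cases hi : i = r
        · subst hi; simp; omega
        · simp [Pi.single_eq_of_ne hi]
  rw [hl, hr, hprod]
  have hpascal : α r ≠ 0 → β r ≠ 0 → (α r + β r).choose (α r) =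
      (α r - 1 + β r).choose (α r - 1) + (α r + (β r - 1)).choose (α r) := by
    intro h1 h2
    obtain ⟨a, ha⟩ := Nat.exists_eq_succ_of_ne_zero h1
    obtain ⟨b, hb⟩ := Nat.exists_eq_succ_of_ne_zero h2
    rw [ha, hb, show a.succ + b.succ = (a + b + 1) + 1 by omega, Nat.choose_succ_succ]
    congr 2
    omega
  by_cases hlt : ∀ i, (α + β) i < p ^ (t i : ℕ)
  · rw [pd_inl_mono hlt]
    by_cases h1 : α r = 0
    · by_cases h2 : β r = 0
      · simp [h1, h2]
      · simp [h1, h2]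
    · by_cases h2 : β r = 0
      · simp [h1, h2]
      · rw [if_neg (by simp [h1]), if_neg h1, if_neg h2, ← add_smul, hpascal h1 h2]
        congr 1
        push_cast
        ring
  · rw [mono_of_not_lt hlt, map_zero, smul_zero]
    by_cases hlt2 : ∀ i, (α + β - Pi.single r 1 : Fin m → ℕ) i < p ^ (t i : ℕ)
    swap
    · simp [mono_of_not_lt hlt2]
    have hsum : α r + β r = p ^ (t r : ℕ) := by
      have h3 : p ^ (t r : ℕ) ≤ α r + β r := by
        by_contra h3
        refine hlt fun i => ?_
        by_cases hi : i = r
        · subst hi; simpa using h3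
        · simpa [Pi.single_eq_of_ne hi] using hlt2 i
      have h4 := hlt2 r
      simp at h4
      omega
    have h1 : α r ≠ 0 := fun h => by have := hβ r; omega
    have h2 : β r ≠ 0 := fun h => by have := hα r; omega
    have hz : (((α r + β r).choose (α r) : ℕ) : F) = 0 := by
      rw [CharP.cast_eq_zero_iff F p, hsum]
      exact (Fact.out : p.Prime).dvd_choose_pow h1 (by omega)
    rw [if_neg h1, if_neg h2, ← add_smul]
    rw [hpascal h1 h2] at hz
    have : (-1 : F) ^ inv u v * (((α r - 1 + β r).choose (α r - 1) * C : ℕ) : F) +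
        (-1 : F) ^ inv u v * (((α r + (β r - 1)).choose (α r) * C : ℕ) : F) = 0 := by
      push_cast at hz ⊢
      linear_combination (-1 : F) ^ inv u v * (C : F) * hz
    rw [this, zero_smul]

theorem inv_erase_left {u : Finset (Fin m)} {r : Fin m} (hr : r ∈ u) (v : Finset (Fin m)) :
    inv u v = inv (u.erase r) v + (v.filter fun j => j < r).card := by
  rw [← inv_singleton_left, ← inv_union_left (by simp)]
  congr 1
  ext i
  simp only [Finset.mem_union, Finset.mem_erase, Finset.mem_singleton]
  by_cases h : i = r <;> simp [h, hr]

theorem inv_erase_right {v : Finset (Fin m)} {r : Fin m} (hr : r ∈ v) (u : Finset (Fin m)) :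
    inv u v = inv u (v.erase r) + (u.filter fun j => r < j).card := by
  rw [← inv_singleton_right, ← inv_union_right (by simp)]
  congr 1
  ext i
  simp only [Finset.mem_union, Finset.mem_erase, Finset.mem_singleton]
  by_cases h : i = r <;> simp [h, hr]

theorem card_lt_add_card_gt {u : Finset (Fin m)} {r : Fin m} (hr : r ∉ u) :
    (u.filter fun j => j < r).card + (u.filter fun j => r < j).card = u.card := by
  rw [← Finset.card_filter_add_card_filter_not (s := u) (fun j => j < r)]
  congr 2
  refine Finset.filter_congr fun j hj => ?_
  have : j ≠ r := fun h => hr (h ▸ hj)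
  rw [not_lt]
  exact ⟨le_of_lt, fun h => lt_of_le_of_ne h this.symm⟩

theorem pd_inr_mul (r : Fin m) {k : ZMod 2} {f : O F p t} (hf : f ∈ homog F k) (g : O F p t) :
    pd (Sum.inr r) (mul f g) =
      mul (pd (Sum.inr r) f) g + koszul 1 k • mul f (pd (Sum.inr r) g) := by
  refine homog_induction (P := fun f => pd (Sum.inr r) (mul f g) =
      mul (pd (Sum.inr r) f) g + koszul 1 k • mul f (pd (Sum.inr r) g)) (by simp)
    (fun a b ha hb => by simp only [map_add, LinearMap.add_apply, ha, hb, smul_add]; abel) ?_ hf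
  intro c α hα u hu
  induction g using mono_induction with
  | h0 => simp
  | hadd a b ha hb => simp only [map_add, ha, hb, smul_add]; abel
  | hm d β hβ v =>
  have hk : ((koszul 1 k : ℤ) : F) = (-1) ^ u.card := by
    have := koszul_card (F := F) 1 u.card
    rwa [hu, one_mul, Nat.cast_one] at this
  simp only [map_smul, LinearMap.smul_apply, smul_comm (koszul 1 k), ← smul_add]
  congr 2
  rw [← Int.cast_smul_eq_zsmul F, hk, pd_inr_mono, pd_inr_mono, mul_mono]
  set C : F := ((∏ i, (α i + β i).choose (α i) : ℕ) : F)
  have hsq : ∀ n : ℕ, ((-1 : F) ^ n) * (-1) ^ n = 1 := fun n => by rw [← mul_pow]; simp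
  by_cases huv : Disjoint u v
  · rw [if_pos huv, map_smul, pd_inr_mono]
    have hfc : ((u ∪ v).filter fun j => j < r).card =
        (u.filter fun j => j < r).card + (v.filter fun j => j < r).card := by
      rw [Finset.filter_union, Finset.card_union_of_disjoint (Finset.disjoint_filter_filter huv)]
    by_cases hru : r ∈ u
    · have hrv : r ∉ v := Finset.disjoint_left.1 huv hru
      rw [if_pos hru, if_neg hrv, if_pos (Finset.mem_union_left _ hru), map_smul,
        LinearMap.smul_apply, mul_mono, if_pos (huv.mono_left (Finset.erase_subset _ _)), hfc,
        inv_erase_left hru, Finset.erase_union_distrib, Finset.erase_eq_of_notMem hrv, map_zero,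
        smul_zero, add_zero, smul_smul, smul_smul, pow_add, pow_add]
      congr 1
      linear_combination ((-1 : F) ^ inv (u.erase r) v * C *
        (-1) ^ (u.filter fun j => j < r).card) * hsq (v.filter fun j => j < r).card
    · by_cases hrv : r ∈ v
      · rw [if_neg hru, if_pos hrv, if_pos (Finset.mem_union_right _ hrv), map_smul, mul_mono,
          if_pos (huv.mono_right (Finset.erase_subset _ _)), hfc, inv_erase_right hrv,
          Finset.erase_union_distrib, Finset.erase_eq_of_notMem hru, map_zero,
          LinearMap.zero_apply, zero_add, smul_smul, smul_smul, smul_smul,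
          ← card_lt_add_card_gt hru, pow_add, pow_add, pow_add]
        congr 1
        ring
      · rw [if_neg hru, if_neg hrv, if_neg (by simp [hru, hrv])]
        simp
  · rw [if_neg huv, map_zero]
    by_cases hr : r ∈ u ∧ r ∈ v
    · obtain ⟨hru, hrv⟩ := hr
      rw [if_pos hru, if_pos hrv, map_smul, map_smul, LinearMap.smul_apply, mul_mono, mul_mono]
      have hiff : Disjoint (u.erase r) v ↔ Disjoint u (v.erase r) := by
        simp only [Finset.disjoint_left, Finset.mem_erase]
        exact ⟨fun h a ha hb => h ⟨hb.1, ha⟩ hb.2, fun h a ha hb => h ha.2 ⟨ha.1, hb⟩⟩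
      by_cases hd : Disjoint (u.erase r) v
      · rw [if_pos hd, if_pos (hiff.1 hd)]
        have hun : u ∪ v.erase r = u.erase r ∪ v := by
          ext i
          by_cases hi : i = r <;> simp [hi, hru, hrv]
        have h1 := inv_erase_right hrv (u.erase r)
        have h2 := inv_erase_left hru (v.erase r)
        have h3 := card_lt_add_card_gt (Finset.notMem_erase r u)
        have h4 := Finset.card_erase_add_one hru
        have h5 : ((v.erase r).filter fun j => j < r).card = (v.filter fun j => j < r).card := by
          rw [Finset.filter_erase, Finset.erase_eq_of_notMem (by simp)]
        have h6 : ((u.erase r).filter fun j => j < r).card = (u.filter fun j => j < r).card := by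
          rw [Finset.filter_erase, Finset.erase_eq_of_notMem (by simp)]
        rw [h5] at h2
        rw [h6] at h3
        rw [hun, h1, h2, ← h4, ← h3, smul_smul, smul_smul, smul_smul, ← add_smul]
        simp only [pow_add, pow_one]
        refine ((congrArg (· • (mono (α + β) (u.erase r ∪ v) : O F p t)) ?_).trans
          (zero_smul F _)).symm
        linear_combination (-((-1 : F) ^ (u.filter fun j => j < r).card *
          (-1 : F) ^ ((u.erase r).filter fun j => r < j).card *
          (-1 : F) ^ inv (u.erase r) (v.erase r) * C)) * hsq (v.filter fun j => j < r).card
      · rw [if_neg hd, if_neg fun h => hd (hiff.2 h)]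
        simp
    · obtain ⟨a, hau, hav⟩ := Finset.not_disjoint_iff.1 huv
      have h1 : mul (if r ∈ u then (-1 : F) ^ (u.filter fun j => j < r).card •
          mono α (u.erase r) else 0 : O F p t) (mono β v) = 0 := by
        split_ifs with h
        · rw [map_smul, LinearMap.smul_apply, mul_mono, if_neg, smul_zero]
          refine Finset.not_disjoint_iff.2 ⟨a, Finset.mem_erase.2 ⟨?_, hau⟩, hav⟩
          rintro rfl
          exact hr ⟨hau, hav⟩
        · simp
      have h2 : mul (mono α u) (if r ∈ v then (-1 : F) ^ (v.filter fun j => j < r).card •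
          mono β (v.erase r) else 0 : O F p t) = 0 := by
        split_ifs with h
        · rw [map_smul, mul_mono, if_neg, smul_zero]
          refine Finset.not_disjoint_iff.2 ⟨a, hau, Finset.mem_erase.2 ⟨?_, hav⟩⟩
          rintro rfl
          exact hr ⟨hau, hav⟩
        · simp
      rw [h1, h2]
      simp

/-- `∂_r` is a superderivation. -/
theorem pd_mul [Fact p.Prime] [CharP F p] (r : Y m) {k : ZMod 2} {f : O F p t}
    (hf : f ∈ homog F k) (g : O F p t) :
    pd r (mul f g) = mul (pd r f) g + koszul (parity r) k • mul f (pd r g) := by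
  rcases r with r | r
  · rw [pd_inl_mul]
    have : koszul 0 k = 1 := by clear hf; revert k; decide
    simp [parity, this]
  · exact pd_inr_mul r hf g

theorem pd_comm (r s : Y m) (f : O F p t) :
    pd r (pd s f) = koszul (parity r) (parity s) • pd s (pd r f) := by
  have k00 : koszul 0 0 = 1 := by decide
  have k01 : koszul 0 1 = 1 := by decide
  have k10 : koszul 1 0 = 1 := by decide
  have k11 : koszul 1 1 = -1 := by decide
  induction f using mono_induction with
  | h0 => simp
  | hadd a b ha hb => simp only [map_add, ha, hb, smul_add]
  | hm c α hα u =>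
  simp only [map_smul, smul_comm (koszul _ _)]
  congr 1
  have hsub : ∀ i j, (α - Pi.single j 1 : Fin m → ℕ) i < p ^ (t i : ℕ) := fun i j =>
    lt_of_le_of_lt (Nat.sub_le _ _) (hα i)
  rcases r with r | r <;> rcases s with s | s <;> simp only [parity, k00, k01, k10, k11, one_smul]
  · by_cases hrs : r = s
    · rw [hrs]
    · rw [pd_inl_mono hα, pd_inl_mono hα]
      by_cases hr : α r = 0 <;> by_cases hs : α s = 0 <;>
        simp only [hr, hs, if_true, if_false, map_zero]
      · rw [pd_inl_mono (fun i => hsub i s)]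
        simp [Pi.single_eq_of_ne hrs, hr]
      · rw [pd_inl_mono (fun i => hsub i r)]
        simp [Pi.single_eq_of_ne (Ne.symm hrs), hs]
      · rw [pd_inl_mono (fun i => hsub i r), pd_inl_mono (fun i => hsub i s)]
        simp [Pi.single_eq_of_ne hrs, Pi.single_eq_of_ne (Ne.symm hrs), hr, hs, tsub_right_comm]
  · rw [pd_inr_mono, pd_inl_mono hα]
    split_ifs <;> simp [pd_inr_mono, pd_inl_mono hα, *]
  · rw [pd_inr_mono, pd_inl_mono hα]
    split_ifs <;> simp [pd_inr_mono, pd_inl_mono hα, *]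
  · by_cases hrs : r = s
    · subst hrs
      rw [pd_inr_mono]
      split_ifs <;> simp [pd_inr_mono]
    · have hsr : s ≠ r := fun h => hrs h.symm
      rw [pd_inr_mono, pd_inr_mono]
      by_cases hr : r ∈ u <;> by_cases hs : s ∈ u <;>
        simp only [hr, hs, if_true, if_false, map_zero, map_smul, pd_inr_mono, Finset.mem_erase,
          ne_eq, hrs, hsr, not_false_eq_true, and_self, and_false, smul_zero]
      rw [Finset.erase_right_comm, smul_smul, smul_smul, neg_smul, one_smul, ← neg_smul]
      congr 1
      have key : ∀ a b : Fin m, a ∈ u → a < b →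
          (((u.erase a).filter fun j => j < b).card + 1 = (u.filter fun j => j < b).card ∧
          ((u.erase b).filter fun j => j < a).card = (u.filter fun j => j < a).card) := by
        intro a b ha hab
        rw [Finset.filter_erase, Finset.filter_erase]
        refine ⟨Finset.card_erase_add_one (by simp [ha, hab]), ?_⟩
        rw [Finset.erase_eq_of_notMem]
        simp [hab.le]
      rcases lt_or_gt_of_ne hrs with h | h
      · obtain ⟨h1, h2⟩ := key r s hr h
        rw [← h1, h2, pow_succ]
        ring
      · obtain ⟨h1, h2⟩ := key s r hs h
        rw [← h1, h2, pow_succ]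
        ring

theorem mul_one' (f : O F p t) : mul f (mono 0 ∅) = f := by
  induction f using mono_induction with
  | h0 => simp
  | hadd a b ha hb => simp only [map_add, LinearMap.add_apply, ha, hb]
  | hm c α _ u =>
    rw [map_smul, LinearMap.smul_apply, mul_mono]
    simp [inv]

theorem pd_var [Fact p.Prime] (r s : Y m) :
    pd r (var s : O F p t) = if r = s then mono 0 ∅ else 0 := by
  have hp : ∀ i, 1 < p ^ (t i : ℕ) := fun i =>
    Nat.one_lt_pow (t i).ne_zero (Fact.out : p.Prime).one_lt
  rcases s with s | s
  · have hs : ∀ i, (Pi.single s 1 : Fin m → ℕ) i < p ^ (t i : ℕ) := fun i => by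
      refine lt_of_le_of_lt ?_ (hp i)
      by_cases h : i = s
      · subst h; simp
      · simp [Pi.single_eq_of_ne h]
    rcases r with r | r
    · rw [var, pd_inl_mono hs]
      by_cases h : r = s
      · subst h; simp
      · simp [h]
    · simp [var, pd_inr_mono]
  · rcases r with r | r
    · rw [var, pd_inl_mono (α := 0) (fun i => (Nat.zero_lt_one.trans (hp i)))]
      simp
    · rw [var, pd_inr_mono]
      by_cases h : r = s
      · subst h; simp [Finset.filter_singleton]
      · simp [h]

/-- The defining property of the divergence. -/
theorem div_mul_pd [Fact p.Prime] (f : O F p t) (r : Y m) :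
    div (mul f * pd r) = pd r (twist (parity r) f) := by
  change ∑ s : Y m, pd s (twist (parity s) (mul f (pd r (var s)))) = _
  rw [Finset.sum_eq_single r]
  · rw [pd_var, if_pos rfl, mul_one']
  · intro s _ hs
    rw [pd_var, if_neg hs.symm]
    simp
  · simp

/-- The element `∑ c_r ∂_r` of `W`. -/
def op (c : Y m → O F p t) : Module.End F (O F p t) := ∑ r : Y m, mul (c r) * pd r

theorem op_apply (c : Y m → O F p t) (f : O F p t) : op c f = ∑ r : Y m, mul (c r) (pd r f) := by
  simp [op]

theorem op_mem_W (c : Y m → O F p t) : op c ∈ W F p t :=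
  Submodule.sum_mem _ fun r _ => Submodule.subset_span ⟨c r, r, rfl⟩

theorem op_var [Fact p.Prime] (c : Y m → O F p t) (s : Y m) : op c (var s) = c s := by
  rw [op_apply, Finset.sum_eq_single s]
  · rw [pd_var, if_pos rfl, mul_one']
  · intro r _ hr
    rw [pd_var, if_neg hr, map_zero]
  · simp

theorem op_mem_homog {c : Y m → O F p t} {d : ZMod 2} (hc : ∀ r, c r ∈ homog F (d + parity r)) :
    op c ∈ homog F d := by
  rw [SuperEnd.mem_homog_iff]
  intro j f hf
  rw [op_apply]
  refine Submodule.sum_mem _ fun r _ => ?_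
  have := mul_mem (hc r) (apply_mem (pd_mem r) hf)
  have e : d + parity r + (j + parity r) = j + d := by
    generalize parity r = a
    clear hc hf this
    revert a d j; decide
  rwa [e] at this

theorem pd_apply_mem {i : ZMod 2} {f : O F p t} (hf : f ∈ homog F i) (r : Y m) :
    pd r f ∈ homog F (i + parity r) := apply_mem (pd_mem r) hf

/-- `∑ c_r ∂_r` is a superderivation. -/
theorem op_mul [Fact p.Prime] [CharP F p] {c : Y m → O F p t} {d : ZMod 2}
    (hc : ∀ r, c r ∈ homog F (d + parity r)) {k : ZMod 2} {f : O F p t} (hf : f ∈ homog F k)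
    (g : O F p t) : op c (mul f g) = mul (op c f) g + koszul d k • mul f (op c g) := by
  simp only [op_apply, map_sum, LinearMap.sum_apply, Finset.smul_sum, ← Finset.sum_add_distrib]
  refine Finset.sum_congr rfl fun r _ => ?_
  rw [pd_mul r hf, map_add, mul_zsmul, ← mul_assoc', ← mul_assoc', ← mul_assoc',
    mul_comm' (hc r) hf, zsmul_mul, smul_smul, koszul_add_left,
    mul_comm (koszul d k), ← mul_assoc, koszul_mul_self, one_mul]

theorem bracket_op [Fact p.Prime] [CharP F p] {c e : Y m → O F p t} {i j : ZMod 2}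
    (hc : ∀ r, c r ∈ homog F (i + parity r)) (he : ∀ r, e r ∈ homog F (j + parity r)) :
    SuperEnd.bracket (op c) (op e) =
      op fun s => op c (e s) - koszul i j • op e (c s) := by
  rw [SuperEnd.bracket_of_mem (op_mem_homog hc) (op_mem_homog he)]
  refine LinearMap.ext fun v => ?_
  simp only [LinearMap.sub_apply, LinearMap.smul_apply, Module.End.mul_apply]
  have h1 : op c (op e v) = ∑ s, mul (op c (e s)) (pd s v) +
      ∑ s, koszul i (j + parity s) • mul (e s) (op c (pd s v)) := by
    rw [op_apply e, map_sum, ← Finset.sum_add_distrib]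
    exact Finset.sum_congr rfl fun s _ => op_mul hc (he s) _
  have h2 : op e (op c v) = ∑ s, mul (op e (c s)) (pd s v) +
      ∑ s, koszul j (i + parity s) • mul (c s) (op e (pd s v)) := by
    rw [op_apply c, map_sum, ← Finset.sum_add_distrib]
    exact Finset.sum_congr rfl fun s _ => op_mul he (hc s) _
  have h3 : ∑ s, koszul i (j + parity s) • mul (e s) (op c (pd s v)) =
      koszul i j • ∑ s, koszul j (i + parity s) • mul (c s) (op e (pd s v)) := by
    simp only [op_apply, map_sum, Finset.smul_sum]
    rw [Finset.sum_comm]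
    refine Finset.sum_congr rfl fun r _ => Finset.sum_congr rfl fun s _ => ?_
    rw [← mul_assoc', ← mul_assoc', mul_comm' (he s) (hc r), pd_comm r s, mul_zsmul, zsmul_mul]
    simp only [smul_smul]
    congr 1
    generalize parity r = a
    generalize parity s = b
    clear h1 h2 hc he
    revert i j a b
    decide
  rw [h1, h2, h3, op_apply]
  simp only [map_sub, LinearMap.sub_apply, Finset.sum_sub_distrib, smul_add, map_zsmul,
    LinearMap.smul_apply, Finset.smul_sum]
  abel

theorem T_eq_op {i : ZMod 2} {a : O F p t} (ha : a ∈ homog F i) :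
    T a = op fun s => koszul (parity s.swap) i • pd s.swap a := by
  change ∑ r : Y m, mul (pd r (twist (parity r) a)) * pd r.swap = _
  unfold op
  refine Fintype.sum_equiv (Equiv.sumComm _ _) _ _ fun r => ?_
  simp [twist_of_mem ha]

theorem parity_swap (r : Y m) : parity r.swap = parity r + 1 := by
  rcases r with r | r
  · rfl
  · change (0 : ZMod 2) = 1 + 1
    decide

theorem coef_T_mem {i : ZMod 2} {a : O F p t} (ha : a ∈ homog F i) (s : Y m) :
    koszul (parity s.swap) i • pd s.swap a ∈ homog F (i + 1 + parity s) := by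
  refine zsmul_mem ?_ _
  have := pd_apply_mem ha s.swap
  rw [parity_swap] at this
  rwa [add_assoc, add_comm 1]

theorem T_mem_homog {i : ZMod 2} {a : O F p t} (ha : a ∈ homog F i) :
    T a ∈ homog F (i + 1) := by
  rw [T_eq_op ha]
  exact op_mem_homog (coef_T_mem ha)

theorem bracket_T_of_mem [Fact p.Prime] [CharP F p] {i j : ZMod 2} {a b : O F p t}
    (ha : a ∈ homog F i) (hb : b ∈ homog F j) :
    SuperEnd.bracket (T a) (T b) = T (T a b) := by
  have hab : T a b ∈ homog F (j + (i + 1)) := apply_mem (T_mem_homog ha) hb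
  rw [T_eq_op hab, T_eq_op ha, T_eq_op hb, bracket_op (coef_T_mem ha) (coef_T_mem hb)]
  congr 1
  funext s
  rw [map_zsmul, map_zsmul]
  have h1 : pd s.swap (op (fun s => koszul (parity s.swap) i • pd s.swap a) b) =
      ∑ r : Y m, mul (pd s.swap (koszul (parity r.swap) i • pd r.swap a)) (pd r b) +
      koszul (parity s.swap) (i + 1) •
        op (fun s => koszul (parity s.swap) i • pd s.swap a) (pd s.swap b) := by
    rw [op_apply, op_apply, map_sum, Finset.smul_sum, ← Finset.sum_add_distrib]
    refine Finset.sum_congr rfl fun r _ => ?_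
    rw [pd_mul s.swap (coef_T_mem ha r), pd_comm s.swap r, mul_zsmul, smul_smul]
    congr 2
    generalize parity s.swap = a
    generalize parity r = b
    clear hab ha hb
    revert i a b
    decide
  have h2 : op (fun s => koszul (parity s.swap) j • pd s.swap b) (pd s.swap a) =
      -(koszul (i + 1) (j + 1) * koszul (parity s.swap) (j + 1)) •
      ∑ r : Y m, mul (pd s.swap (koszul (parity r.swap) i • pd r.swap a)) (pd r b) := by
    rw [op_apply, Finset.smul_sum]
    refine Fintype.sum_equiv (Equiv.sumComm _ _) _ _ fun r => ?_
    rw [Equiv.sumComm_apply, Sum.swap_swap, zsmul_mul, pd_zsmul, zsmul_mul,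
      mul_comm' (pd_apply_mem hb r.swap) (pd_apply_mem (pd_apply_mem ha _) _),
      pd_comm r s.swap, zsmul_mul]
    simp only [smul_smul]
    congr 1
    rw [parity_swap r]
    generalize parity s.swap = a
    generalize parity r = b
    clear h1 hab ha hb
    revert i j a b
    decide
  rw [h1, h2, smul_add, smul_smul, smul_smul, smul_smul]
  generalize op (fun s => koszul (parity s.swap) i • pd s.swap a) (pd s.swap b) = X
  generalize ∑ r : Y m, mul (pd s.swap (koszul (parity r.swap) i • pd r.swap a)) (pd r b) = Z
  generalize parity s.swap = q
  clear h1 h2 hab ha hb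
  have e1 : koszul q (j + (i + 1)) * koszul q (i + 1) = koszul q j := by
    revert i j q; decide
  have e2 : koszul (i + 1) (j + 1) * koszul q i * (-(koszul (i + 1) (j + 1) * koszul q (j + 1))) =
      -koszul q (j + (i + 1)) := by
    revert i j q; decide
  rw [e1, e2, neg_smul, sub_neg_eq_add, add_comm]

theorem bracket_T [Fact p.Prime] [CharP F p] (a b : O F p t) :
    SuperEnd.bracket (T a) (T b) = T (T a b) := by
  rw [← sum_proj (F := F) a, ← sum_proj (F := F) b]
  simp only [map_sum, LinearMap.sum_apply]
  refine Finset.sum_congr rfl fun i _ => Finset.sum_congr rfl fun j _ => ?_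
  exact bracket_T_of_mem (proj_mem _ _) (proj_mem _ _)

theorem HO_le_W : HO F p t ≤ W F p t := by
  rintro _ ⟨a, rfl⟩
  rw [← sum_proj (F := F) a, map_sum]
  refine Submodule.sum_mem _ fun i _ => ?_
  rw [T_eq_op (proj_mem i a)]
  exact op_mem_W _

theorem proj_T (i : ZMod 2) (a : O F p t) :
    proj (F := F) (V := Module.End F (O F p t)) i (T a) = T (proj (F := F) (i + 1) a) := by
  have h : T a = ∑ j : ZMod 2, T (proj (F := F) j a) := by rw [← map_sum, sum_proj]
  rw [h, map_sum, Finset.sum_eq_single (i + 1)]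
  · rw [proj_of_mem (T_mem_homog (proj_mem _ _)), if_pos]
    revert i; decide
  · intro j _ hj
    rw [proj_of_mem (T_mem_homog (proj_mem _ _)), if_neg]
    rintro rfl
    apply hj
    clear hj
    revert j; decide
  · simp

theorem parity_var (r : Y m) : (var r : O F p t) ∈ homog F (parity r) := by
  rcases r with r | r
  · simpa [parity, var] using mono_mem (F := F) (p := p) (t := t) (Pi.single r 1) ∅
  · simpa [parity, var] using mono_mem (F := F) (p := p) (t := t) 0 {r}

theorem div_mem {i : ZMod 2} {D : Module.End F (O F p t)} (hD : D ∈ homog F i) :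
    div D ∈ homog F i := by
  change ∑ r : Y m, pd r (twist (parity r) (D (var r))) ∈ _
  refine Submodule.sum_mem _ fun r _ => ?_
  have h1 := apply_mem hD (parity_var r)
  rw [twist_of_mem h1, pd_zsmul]
  refine zsmul_mem ?_ _
  have h2 := pd_apply_mem h1 r
  have e : parity r + i + parity r = i := by
    generalize parity r = a
    clear hD h1 h2
    revert a i; decide
  rwa [e] at h2

theorem div_proj (i : ZMod 2) (D : Module.End F (O F p t)) :
    div (proj (F := F) (V := Module.End F (O F p t)) i D) = proj (F := F) i (div D) := by
  have h : div D = ∑ j : ZMod 2, div (proj (F := F) (V := Module.End F (O F p t)) j D) := by rw [← map_sum, sum_proj]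
  rw [h, map_sum, Finset.sum_eq_single i]
  · rw [mem_homog.1 (div_mem (proj_mem i D))]
  · intro j _ hj
    rw [proj_of_mem (div_mem (proj_mem j D)), if_neg hj.symm]
  · simp

theorem div_op [Fact p.Prime] {c : Y m → O F p t} {d : ZMod 2}
    (hc : ∀ r, c r ∈ homog F (d + parity r)) :
    div (op c) = ∑ r : Y m, koszul (parity r) (d + parity r) • pd r (c r) := by
  change ∑ r : Y m, pd r (twist (parity r) (op c (var r))) = _
  refine Finset.sum_congr rfl fun r _ => ?_
  rw [op_var, twist_of_mem (hc r), pd_zsmul]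

theorem div_bracket_op [Fact p.Prime] [CharP F p] {c e : Y m → O F p t} {i j : ZMod 2}
    (hc : ∀ r, c r ∈ homog F (i + parity r)) (he : ∀ r, e r ∈ homog F (j + parity r)) :
    div (SuperEnd.bracket (op c) (op e)) =
      op c (div (op e)) - koszul i j • op e (div (op c)) := by
  have hce : ∀ r, op c (e r) - koszul i j • op e (c r) ∈ homog F (i + j + parity r) := by
    intro r
    have h1 := apply_mem (op_mem_homog hc) (he r)
    have h2 := apply_mem (op_mem_homog he) (hc r)
    refine Submodule.sub_mem _ ?_ (zsmul_mem ?_ _)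
    · rwa [show i + j + parity r = j + parity r + i by abel]
    · rwa [show i + j + parity r = i + parity r + j by abel]
  have expand : ∀ {c : Y m → O F p t} {d : ZMod 2} (_ : ∀ r, c r ∈ homog F (d + parity r))
      (s : Y m) (g : O F p t), pd s (op c g) =
      ∑ r : Y m, mul (pd s (c r)) (pd r g) + koszul (parity s) d • op c (pd s g) := by
    intro c d hc s g
    rw [op_apply, op_apply, map_sum, Finset.smul_sum, ← Finset.sum_add_distrib]
    refine Finset.sum_congr rfl fun r _ => ?_
    rw [pd_mul s (hc r), pd_comm s r, mul_zsmul, smul_smul]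
    congr 2
    generalize parity s = a
    generalize parity r = b
    clear hc
    revert d a b
    decide
  rw [bracket_op hc he, div_op hce, div_op hc, div_op he]
  have hcross : ∑ s : Y m, koszul (parity s) (i + j + parity s) •
        ∑ r : Y m, mul (pd s (c r)) (pd r (e s)) =
      koszul i j • ∑ s : Y m, koszul (parity s) (i + j + parity s) •
        ∑ r : Y m, mul (pd s (e r)) (pd r (c s)) := by
    simp only [Finset.smul_sum]
    rw [Finset.sum_comm]
    refine Finset.sum_congr rfl fun r _ => Finset.sum_congr rfl fun s _ => ?_
    rw [mul_comm' (pd_apply_mem (hc r) s) (pd_apply_mem (he s) r), smul_smul, smul_smul]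
    congr 1
    generalize parity r = a
    generalize parity s = b
    clear hc he hce expand
    revert i j a b
    decide
  have hsum : ∀ (c e : Y m → O F p t) (i j : ZMod 2) (_ : ∀ r, c r ∈ homog F (i + parity r)),
      ∑ s : Y m, koszul (parity s) (i + j + parity s) • pd s (op c (e s)) =
      ∑ s : Y m, koszul (parity s) (i + j + parity s) • ∑ r : Y m, mul (pd s (c r)) (pd r (e s)) +
      op c (∑ s : Y m, koszul (parity s) (j + parity s) • pd s (e s)) := by
    intro c e i j hc
    rw [map_sum, ← Finset.sum_add_distrib]
    refine Finset.sum_congr rfl fun s _ => ?_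
    rw [expand hc, smul_add, smul_smul, map_zsmul]
    congr 2
    generalize parity s = a
    clear hcross hce hc he
    revert i j a
    decide
  simp only [map_sub, smul_sub, Finset.sum_sub_distrib, pd_zsmul]
  have hcomm : ∀ s : Y m, koszul (parity s) (i + j + parity s) • koszul i j • pd s (op e (c s)) =
      koszul i j • koszul (parity s) (j + i + parity s) • pd s (op e (c s)) := by
    intro s
    rw [smul_comm, add_comm i j]
  simp only [hcomm]
  rw [← Finset.smul_sum, hsum c e i j hc, hsum e c j i he, hcross, smul_add, add_comm j i]
  abel

variable (F p t) in
/-- The special odd Hamiltonian superalgebra `SHO(m, m; t) = S' ∩ HO`. -/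
def SHO [Fact p.Prime] [CharP F p] : LieSubsuperalgebra F (Module.End F (O F p t)) where
  carrier := S' F p t ⊓ HO F p t
  proj_mem := by
    rintro i _ ⟨⟨_, hdiv⟩, a, rfl⟩
    have h : proj (F := F) (V := Module.End F (O F p t)) i (T a) ∈ HO F p t := ⟨_, (proj_T i a).symm⟩
    refine ⟨⟨HO_le_W h, ?_⟩, h⟩
    rw [SetLike.mem_coe, LinearMap.mem_ker, div_proj, LinearMap.mem_ker.1 hdiv, map_zero]
  br_mem := by
    rintro _ _ ⟨⟨_, hdiv⟩, a, rfl⟩ ⟨⟨_, hdiv'⟩, b, rfl⟩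
    have h : SuperEnd.bracket (T a) (T b) ∈ HO F p t := ⟨_, (bracket_T a b).symm⟩
    refine ⟨⟨HO_le_W h, ?_⟩, h⟩
    change div (SuperEnd.bracket (T a) (T b)) = 0
    have key : ∀ (a : O F p t), div (T a) = 0 → ∀ i : ZMod 2, div (T (proj (F := F) i a)) = 0 := by
      intro a ha i
      have := proj_T (i + 1) a
      rw [show i + 1 + 1 = i by clear this; revert i; decide] at this
      rw [← this, div_proj, ha, map_zero]
    conv_lhs => rw [← sum_proj (F := F) a, ← sum_proj (F := F) b]
    simp only [map_sum, LinearMap.sum_apply]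
    refine Finset.sum_eq_zero fun i _ => Finset.sum_eq_zero fun j _ => ?_
    have h1 := key a hdiv j
    have h2 := key b hdiv' i
    rw [T_eq_op (proj_mem j a)] at h1 ⊢
    rw [T_eq_op (proj_mem i b)] at h2 ⊢
    rw [div_bracket_op (coef_T_mem (proj_mem j a)) (coef_T_mem (proj_mem i b)), h1, h2]
    simp

variable (F p t) in
/-- `SHO(m, m; t)^(2)`, the second derived algebra. -/
def SHO2 [Fact p.Prime] [CharP F p] : LieSubsuperalgebra F (Module.End F (O F p t)) :=
  (SHO F p t).derived.derived

end

end OddHam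

/-!
Write `L = SHO(m, m; t)^(2)`; it consists of Hamiltonian operators `T a`, and
`[T a, T b] = T (T a b)`.

If `L` is restricted, then for each `i` there is an odd `a` such that `T a` acts on `L` as the
`p`-th power of `T x_{i'} = -∂_i` (`exists_T_eq_pow_of_isRestricted`). Since `m ≥ 3`, `L` contains
`T x_j` for all `j` and `T x_i^(n)` for all `n` (`T_mono_single_mem_SHO2`). The former forces
`q = ∂_{i'} a` to be constant; if `t i > 1`, then `T x_i^(p+1)` forces `q x_i^(p-1) = 1`, which is
impossible (`eq_one_of_isRestricted`).

If `t = (1, …, 1)`, then the associative `p`-th power is a `p`-mapping on the even part of `L`.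
The only point is that it preserves `L`, and by Jacobson's formula (`add_pow_prime`) this may be
checked on a spanning set. Give `x_i` the weight `ε_i` and `x_{i'}` the weight `-ε_i`. The bracket
and the Laplacian respect weights, so `L` is spanned by elements `T a` with `a` homogeneous for
weight and parity (`SHO2_le_span_homogElements`). For odd `a` of weight `γ`, both `T a` and its
`p`-th power are even derivations of `O(m, m; t)` and of its odd Poisson bracket, and such a
derivation vanishes as soon as it kills the even variables `x_j`
(`IsPoissonDerivation.eq_zero`). If `γ ≠ 0`, then `(T a) ^ p` kills these, because a shift of the
weight by `p γ` leaves the range of weights (`T_pow_prime_eq_zero`). If `γ = 0`, then `a` is a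
polynomial in the products `x_k x_{k'}`, whose squares vanish, and `T a` multiplies `x_j` by an
element `g_j` on which it acts trivially. Hence `(T a) ^ p x_j = g_j ^ p x_j`, where `g_j ^ p` is
the `p`-th power of the constant term of `g_j`. So `(T a) ^ p = T b` for a linear combination `b`
of the `x_k x_{k'}`; the coefficients of `b` add up to zero because the Laplacian of `a` vanishes,
and therefore `T b` lies in `L` (`T_pow_prime_mem_of_weight_zero`).
-/

/-! ### Jacobson's formula in associative algebras of characteristic `p` -/

section Associative

open Polynomial

/-- In characteristic `p` one has `binom(p - 1, k) = (-1) ^ k`. -/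
theorem cast_choose_pred_prime {R : Type*} [Ring R] (p : ℕ) [Fact p.Prime] [CharP R p] {k : ℕ}
    (hk : k < p) : ((p - 1).choose k : R) = (-1) ^ k := by
  have hp := (Fact.out : p.Prime).pos
  induction k with
  | zero => simp
  | succ k ih =>
    have h1 : p.choose (k + 1) = (p - 1).choose k + (p - 1).choose (k + 1) := by
      conv_lhs => rw [← Nat.sub_add_cancel hp]
      exact Nat.choose_succ_succ _ _
    have h2 : ((p.choose (k + 1) : ℕ) : R) = 0 := by
      rw [CharP.cast_eq_zero_iff R p]
      exact (Fact.out : p.Prime).dvd_choose_self k.succ_ne_zero hk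
    rw [h1, Nat.cast_add, ih (by omega)] at h2
    rw [pow_succ, mul_neg_one]
    exact eq_neg_of_add_eq_zero_right h2

theorem Commute.sub_pow_pred_prime {R : Type*} [Ring R] (p : ℕ) [Fact p.Prime] [CharP R p]
    {a b : R} (h : Commute a b) :
    (a - b) ^ (p - 1) = ∑ k ∈ Finset.range p, a ^ k * b ^ (p - 1 - k) := by
  have hp := (Fact.out : p.Prime).pos
  rw [sub_eq_add_neg, h.neg_right.add_pow, Nat.sub_add_cancel hp]
  refine Finset.sum_congr rfl fun k hk => ?_
  have hk := Finset.mem_range.1 hk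
  rw [← Nat.choose_symm (by omega : k ≤ p - 1), cast_choose_pred_prime p (by omega), neg_pow b,
    mul_assoc, ((Commute.neg_one_left (b ^ (p - 1 - k))).pow_left (p - 1 - k)).eq,
    ← mul_assoc, mul_assoc, mul_assoc, ← (Commute.refl (-1 : R)).mul_pow]
  simp

variable {F A : Type*} [Field F] [Ring A] [Algebra F A]

theorem charP_of_algebra (F A : Type*) [Field F] [Ring A] [Algebra F A] [Nontrivial A] (p : ℕ)
    [CharP F p] : CharP A p :=
  charP_of_injective_algebraMap (algebraMap F A).injective p

/-- `(ad x) ^ p = ad (x ^ p)` in an associative algebra of characteristic `p`. -/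
theorem commutator_iterate_prime (p : ℕ) [Fact p.Prime] [CharP F p] (x z : A) :
    (fun z => x * z - z * x)^[p] z = x ^ p * z - z * x ^ p := by
  cases subsingleton_or_nontrivial A
  · exact Subsingleton.elim _ _
  have := charP_of_algebra F (Module.End F A) p
  have h := congrArg (fun f : Module.End F A => f z)
    (sub_pow_char_of_commute p (LinearMap.commute_mulLeft_right (R := F) x x))
  simp only [LinearMap.pow_mulLeft, LinearMap.pow_mulRight, LinearMap.sub_apply,
    LinearMap.mulLeft_apply, LinearMap.mulRight_apply, Module.End.pow_apply] at h
  exact h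

/-- The coefficients of `(ad (T x + y)) ^ n (x)`, in an associative algebra. -/
def commutatorCoeff (x y : A) : ℕ → ℕ → A
  | 0, 0 => x
  | 0, _ + 1 => 0
  | n + 1, 0 => y * commutatorCoeff x y n 0 - commutatorCoeff x y n 0 * y
  | n + 1, k + 1 => (y * commutatorCoeff x y n (k + 1) - commutatorCoeff x y n (k + 1) * y) +
      (x * commutatorCoeff x y n k - commutatorCoeff x y n k * x)

theorem coeff_commutator_iterate (x y : A) (n k : ℕ) :
    (((fun z => (C x * X + C y) * z - z * (C x * X + C y))^[n] (C x : A[X])).coeff k) =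
      commutatorCoeff x y n k := by
  induction n generalizing k with
  | zero =>
    cases k with
    | zero => simp [commutatorCoeff]
    | succ k => simp [commutatorCoeff]
  | succ n ih =>
    rw [Function.iterate_succ_apply']
    have h : ∀ z : A[X], (C x * X + C y) * z - z * (C x * X + C y) =
        (C x * z - z * C x) * X + (C y * z - z * C y) := by
      intro z
      have := X_mul (p := z)
      simp only [add_mul, mul_add, sub_mul, mul_assoc, this]
      abel
    rw [h]
    cases k with
    | zero => simp [commutatorCoeff, ih]
    | succ k =>
      simp only [coeff_add, coeff_mul_X, coeff_sub, coeff_C_mul, coeff_mul_C, ih, commutatorCoeff]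
      abel

theorem derivative_pow_noncomm (w : A[X]) (n : ℕ) :
    derivative (w ^ n) = ∑ k ∈ Finset.range n, w ^ k * derivative w * w ^ (n - 1 - k) := by
  induction n with
  | zero => simp
  | succ n ih =>
    rw [pow_succ, derivative_mul, ih, Finset.sum_range_succ, Finset.sum_mul]
    simp only [Nat.add_sub_cancel, Nat.sub_self, pow_zero, mul_one]
    congr 1
    refine Finset.sum_congr rfl fun k hk => ?_
    have hk := Finset.mem_range.1 hk
    rw [mul_assoc _ _ w, ← pow_succ, show n - 1 - k + 1 = n - k by omega]

/-- The coefficients of `(T x + y) ^ p` are Jacobson's Lie polynomials: the derivative of this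
power is `∑ k, w ^ k x w ^ (p - 1 - k) = (ad w) ^ (p - 1) (x)`, with `w = T x + y`. -/
theorem coeff_add_pow_prime (p : ℕ) [Fact p.Prime] [CharP F p] (x y : A) (i : ℕ) :
    ((i + 1 : ℕ) : F) • ((C x * X + C y : A[X]) ^ p).coeff (i + 1) =
      commutatorCoeff x y (p - 1) i := by
  cases subsingleton_or_nontrivial A
  · exact Subsingleton.elim _ _
  have := charP_of_algebra F (Module.End F A[X]) p
  set w : A[X] := C x * X + C y with hw
  have h := congrArg (fun f : Module.End F A[X] => f (C x))
    ((LinearMap.commute_mulLeft_right (R := F) w w).sub_pow_pred_prime p)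
  simp only [LinearMap.pow_mulLeft, LinearMap.pow_mulRight, LinearMap.sum_apply,
    Module.End.mul_apply, LinearMap.mulLeft_apply, LinearMap.mulRight_apply,
    Module.End.pow_apply] at h
  have hd : derivative w = C x := by simp [hw]
  have h2 := derivative_pow_noncomm w p
  rw [hd] at h2
  simp only [mul_assoc] at h2
  rw [← h2] at h
  have h3 := congrArg (fun q : A[X] => q.coeff i) h
  simp only [coeff_derivative] at h3
  rw [← coeff_commutator_iterate]
  refine Eq.trans ?_ h3.symm
  rw [Nat.cast_smul_eq_nsmul, nsmul_eq_mul, ← Nat.cast_succ, (Nat.cast_commute _ _).eq]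

theorem add_pow_prime (p : ℕ) [Fact p.Prime] [CharP F p] (x y : A) :
    (x + y) ^ p = x ^ p + y ^ p +
      ∑ i ∈ Finset.Icc 1 (p - 1), (i : F)⁻¹ • commutatorCoeff x y (p - 1) (i - 1) := by
  have hp := (Fact.out : p.Prime).two_le
  set w : A[X] := C x * X + C y with hw
  have hdeg : w.natDegree ≤ 1 := natDegree_linear_le
  have h1 : (x + y) ^ p = ∑ i ∈ Finset.range (p + 1), (w ^ p).coeff i := by
    have e := map_pow (eval₂RingHom' (RingHom.id A) 1 fun a => Commute.one_right _) w p
    change eval₂ (RingHom.id A) 1 (w ^ p) = (eval₂ (RingHom.id A) 1 w) ^ p at e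
    rw [eval₂_eq_sum_range' _ (n := p + 1)] at e
    · have e2 : eval₂ (RingHom.id A) 1 w = x + y := by
        rw [eval₂_eq_sum_range' _ (Nat.lt_succ_of_le hdeg)]
        simp [Finset.sum_range_succ, hw, add_comm]
      rw [e2] at e
      simpa using e.symm
    · exact Nat.lt_succ_of_le ((natDegree_pow_le_of_le p hdeg).trans (by simp))
  have hx : (w ^ p).coeff p = x ^ p := by
    have := coeff_pow_of_natDegree_le (m := p) hdeg
    rw [mul_one] at this
    rw [this]
    simp [hw]
  have hy : (w ^ p).coeff 0 = y ^ p := by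
    change constantCoeff (w ^ p) = _
    rw [map_pow]
    simp [hw]
  have hr : Finset.range (p + 1) = insert 0 (insert p (Finset.Icc 1 (p - 1))) := by
    ext i
    simp only [Finset.mem_range, Finset.mem_insert, Finset.mem_Icc]
    omega
  rw [h1, hr, Finset.sum_insert, Finset.sum_insert, hx, hy, ← add_assoc, add_comm (y ^ p)]
  · congr 1
    refine Finset.sum_congr rfl fun i hi => ?_
    have hi := Finset.mem_Icc.1 hi
    have h := coeff_add_pow_prime (F := F) p x y (i - 1)
    rw [Nat.sub_add_cancel hi.1] at h
    rw [← h, smul_smul, inv_mul_cancel₀, one_smul]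
    rw [Ne, CharP.cast_eq_zero_iff F p]
    exact fun hd => absurd (Nat.le_of_dvd (by omega) hd) (by omega)
  · simp only [Finset.mem_Icc]; omega
  · simp only [Finset.mem_insert, Finset.mem_Icc]; omega

end Associative

/-! ### Brackets with even endomorphisms -/

namespace SuperEnd

open SuperSpace LieSuperalgebra

variable {F V : Type*} [Field F] [AddCommGroup V] [Module F V] [SuperSpace F V]

theorem bracket_of_even {x : Module.End F V} (hx : x ∈ homog F 0) (z : Module.End F V) :
    bracket x z = x * z - z * x := by
  conv_lhs => rw [← sum_proj (F := F) z, map_sum]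
  conv_rhs => rw [← sum_proj (F := F) z, Finset.mul_sum, Finset.sum_mul, ← Finset.sum_sub_distrib]
  refine Finset.sum_congr rfl fun j _ => ?_
  have : koszul 0 j = 1 := by revert j; decide
  rw [bracket_of_mem hx (proj_mem j z), this, one_smul]

theorem one_mem : (1 : Module.End F V) ∈ homog F 0 :=
  mem_homog_iff.2 fun j v hv => by simpa using hv

theorem pow_mem {x : Module.End F V} (hx : x ∈ homog F 0) (n : ℕ) : x ^ n ∈ homog F 0 := by
  induction n with
  | zero => exact one_mem
  | succ n ih => simpa [pow_succ] using mul_mem ih hx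

theorem bracket_pow_prime (p : ℕ) [Fact p.Prime] [CharP F p] {x : Module.End F V}
    (hx : x ∈ homog F 0) (z : Module.End F V) : bracket (x ^ p) z = (bracket x)^[p] z := by
  have h : ⇑(bracket x) = fun z => x * z - z * x := funext (bracket_of_even hx)
  rw [bracket_of_even (pow_mem hx p), h, commutator_iterate_prime (F := F)]

theorem adCoeff_eq_commutatorCoeff {x y : Module.End F V} (hx : x ∈ homog F 0)
    (hy : y ∈ homog F 0) (n k : ℕ) : adCoeff F x y n k = commutatorCoeff x y n k := by
  have h : ∀ a b : Module.End F V, br (F := F) a b = bracket a b := fun _ _ => rfl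
  induction n generalizing k with
  | zero => cases k <;> rfl
  | succ n ih =>
    cases k <;> simp [adCoeff, commutatorCoeff, h, bracket_of_even hx, bracket_of_even hy, ih]

/-- Jacobson's formula for the associative `p`-th power of even endomorphisms. -/
theorem add_pow_eq_jacobson (p : ℕ) [Fact p.Prime] [CharP F p] {x y : Module.End F V}
    (hx : x ∈ homog F 0) (hy : y ∈ homog F 0) :
    (x + y) ^ p = x ^ p + y ^ p + ∑ i ∈ Finset.Icc 1 (p - 1), jacobson F p x y i := by
  rw [add_pow_prime (F := F)]
  congr 1
  exact Finset.sum_congr rfl fun i _ => by rw [jacobson, adCoeff_eq_commutatorCoeff hx hy]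

end SuperEnd

namespace LieSubsuperalgebra

open SuperSpace LieSuperalgebra

variable {F L : Type*} [Field F] [AddCommGroup L] [Module F L] [SuperSpace F L]
  [LieSuperalgebra F L]

theorem coe_adCoeff (K : LieSubsuperalgebra F L) (x y : K.carrier) (n k : ℕ) :
    ((adCoeff F x y n k : K.carrier) : L) = adCoeff F (x : L) (y : L) n k := by
  have h : ∀ a b : K.carrier, ((br (F := F) a b : K.carrier) : L) = br (F := F) (a : L) (b : L) :=
    fun _ _ => rfl
  induction n generalizing k with
  | zero => cases k <;> rfl
  | succ n ih => cases k <;> simp [adCoeff, h, ih]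

theorem coe_jacobson (K : LieSubsuperalgebra F L) (p : ℕ) (x y : K.carrier) (i : ℕ) :
    ((jacobson F p x y i : K.carrier) : L) = jacobson F p (x : L) (y : L) i := by
  simp [jacobson, coe_adCoeff]

theorem coe_iterate_br (K : LieSubsuperalgebra F L) (x z : K.carrier) (n : ℕ) :
    (((br (F := F) x)^[n] z : K.carrier) : L) = (br (F := F) (x : L))^[n] z := by
  induction n with
  | zero => rfl
  | succ n ih =>
    rw [Function.iterate_succ_apply', Function.iterate_succ_apply', ← ih]
    rfl

theorem br_mem_derived (K : LieSubsuperalgebra F L) {x y : L} (hx : x ∈ K.carrier)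
    (hy : y ∈ K.carrier) : br (F := F) x y ∈ K.derived.carrier :=
  Submodule.subset_span ⟨x, hx, y, hy, rfl⟩

theorem derived_le (K : LieSubsuperalgebra F L) : K.derived.carrier ≤ K.carrier := by
  refine Submodule.span_le.2 ?_
  rintro _ ⟨x, hx, y, hy, rfl⟩
  exact K.br_mem _ _ hx hy

theorem exists_br_eq_iterate_of_isRestricted (K : LieSubsuperalgebra F L) {p : ℕ}
    (h : IsRestricted F K.carrier p) {x : L} (hx : x ∈ K.carrier) (hx0 : x ∈ homog F 0) :
    ∃ y ∈ K.carrier, y ∈ homog F 0 ∧ ∀ z ∈ K.carrier, br (F := F) y z = (br (F := F) x)^[p] z := by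
  obtain ⟨pm, had, -, -⟩ := h
  let x' : homog F (V := K.carrier) 0 := ⟨⟨x, hx⟩, K.coe_mem_homog.2 hx0⟩
  refine ⟨(pm x').1, (pm x').1.2, K.coe_mem_homog.1 (pm x').2, fun z hz => ?_⟩
  exact (congrArg Subtype.val (had x' ⟨z, hz⟩)).trans (K.coe_iterate_br x'.1 ⟨z, hz⟩ p)

variable {V : Type*} [AddCommGroup V] [Module F V] [SuperSpace F V]

/-- A sub-superalgebra of `gl(V)` whose even part is closed under the associative `p`-th power
is restricted. -/
theorem isRestricted_of_pow_mem (p : ℕ) [Fact p.Prime] [CharP F p]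
    (K : LieSubsuperalgebra F (Module.End F V))
    (h : ∀ x ∈ K.carrier, x ∈ homog F 0 → x ^ p ∈ K.carrier) : IsRestricted F K.carrier p := by
  have hev : ∀ x : homog F (V := K.carrier) 0, ((x : K.carrier) : Module.End F V) ∈ homog F 0 :=
    fun x => K.coe_mem_homog.1 x.2
  refine ⟨fun x => ⟨⟨_, h _ x.1.2 (hev x)⟩, K.coe_mem_homog.2 (SuperEnd.pow_mem (hev x) p)⟩,
    fun x z => ?_, fun c x => ?_, fun x y => ?_⟩
  · apply Subtype.ext
    rw [coe_iterate_br]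
    exact SuperEnd.bracket_pow_prime p (hev x) _
  · apply Subtype.ext
    apply Subtype.ext
    exact smul_pow c _ p
  · apply Subtype.ext
    have := SuperEnd.add_pow_eq_jacobson p (hev x) (hev y)
    simp only [Submodule.coe_add, AddSubmonoidClass.coe_finsetSum, coe_jacobson]
    exact this

/-- By Jacobson's formula the even elements of `K` whose `p`-th power lies in `K` form a subspace,
so it suffices to consider a spanning set. -/
theorem pow_mem_of_span (p : ℕ) [Fact p.Prime] [CharP F p]
    (K : LieSubsuperalgebra F (Module.End F V)) {S : Set (Module.End F V)}
    (hspan : K.carrier ≤ Submodule.span F S) (hSK : S ⊆ K.carrier)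
    (hS : ∀ x ∈ S, proj (F := F) 0 x ^ p ∈ K.carrier) {x : Module.End F V} (hx : x ∈ K.carrier)
    (hx0 : x ∈ homog F 0) : x ^ p ∈ K.carrier := by
  have hp := (Fact.out : p.Prime).ne_zero
  have had : ∀ a ∈ K.carrier, ∀ b ∈ K.carrier, ∀ n k, adCoeff F a b n k ∈ K.carrier := by
    intro a ha b hb n
    induction n with
    | zero =>
      rintro (_ | k)
      · exact ha
      · exact K.carrier.zero_mem
    | succ n ih =>
      rintro (_ | k)
      · exact K.br_mem _ _ hb (ih _)
      · exact K.carrier.add_mem (K.br_mem _ _ hb (ih _)) (K.br_mem _ _ ha (ih _))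
  suffices H : proj (F := F) 0 x ∈ K.carrier ∧ proj (F := F) 0 x ^ p ∈ K.carrier by
    rw [mem_homog.1 hx0] at H
    exact H.2
  refine Submodule.span_induction (p := fun x _ => proj (F := F) 0 x ∈ K.carrier ∧
    proj (F := F) 0 x ^ p ∈ K.carrier) ?_ ?_ ?_ ?_ (hspan hx)
  · exact fun x hx => ⟨K.proj_mem _ _ (hSK hx), hS x hx⟩
  · simp [hp]
  · rintro a b - - ⟨ha, ha'⟩ ⟨hb, hb'⟩
    rw [map_add]
    refine ⟨K.carrier.add_mem ha hb, ?_⟩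
    rw [SuperEnd.add_pow_eq_jacobson p (SuperSpace.proj_mem _ _) (SuperSpace.proj_mem _ _)]
    exact K.carrier.add_mem (K.carrier.add_mem ha' hb')
      (K.carrier.sum_mem fun i _ => K.carrier.smul_mem _ (had _ ha _ hb _ _))
  · rintro c a - ⟨ha, ha'⟩
    rw [map_smul, smul_pow]
    exact ⟨K.carrier.smul_mem _ ha, K.carrier.smul_mem _ ha'⟩

end LieSubsuperalgebra

namespace OddHam

open SuperSpace LieSuperalgebra

variable {F : Type*} [Field F] {p m : ℕ} {t : Fin m → ℕ+}

/-! ### Hamiltonian operators and the odd Laplacian -/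

theorem koszul_zero_left (i : ZMod 2) : koszul 0 i = 1 := by revert i; decide

theorem koszul_zero_right (i : ZMod 2) : koszul i 0 = 1 := by revert i; decide

theorem koszul_one_one : koszul 1 1 = -1 := by decide

theorem mono_ne_zero {α : Fin m → ℕ} (h : ∀ i, α i < p ^ (t i : ℕ)) (u : Finset (Fin m)) :
    (mono α u : O F p t) ≠ 0 := by
  rw [mono_of_lt h]
  exact fun h0 => one_ne_zero (α := F) (Finsupp.single_eq_zero.1 h0)

theorem mono_zero_ne_zero [Fact p.Prime] : (mono 0 ∅ : O F p t) ≠ 0 :=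
  mono_ne_zero (fun _ => pow_pos (Fact.out : p.Prime).pos _) _

instance [Fact p.Prime] : Nontrivial (O F p t) := ⟨⟨_, _, mono_zero_ne_zero⟩⟩

theorem one_mul' (f : O F p t) : mul (mono 0 ∅) f = f := by
  induction f using mono_induction with
  | h0 => simp
  | hadd a b ha hb => simp only [map_add, ha, hb]
  | hm c α _ u => rw [map_smul, mul_mono]; simp [inv]

theorem T_apply {i : ZMod 2} {a : O F p t} (ha : a ∈ homog F i) (f : O F p t) :
    T a f = ∑ s : Fin m, (koszul 1 i • mul (pd (Sum.inr s) a) (pd (Sum.inl s) f) +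
      mul (pd (Sum.inl s) a) (pd (Sum.inr s) f)) := by
  rw [T_eq_op ha, op_apply, Fintype.sum_sum_type, Finset.sum_add_distrib]
  simp [parity, koszul_zero_left]

theorem T_inl_var [Fact p.Prime] (l : Fin m) :
    T (var (Sum.inl l) : O F p t) = pd (Sum.inr l) := by
  refine LinearMap.ext fun f => ?_
  rw [T_apply (parity_var (Sum.inl l)), Finset.sum_eq_single l]
  · rw [pd_var, pd_var, if_pos rfl, if_neg (by simp), one_mul']
    simp
  · intro j _ hj
    rw [pd_var, pd_var, if_neg (by simp), if_neg (by simp [hj])]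
    simp
  · simp

theorem T_inr_var [Fact p.Prime] (l : Fin m) :
    T (var (Sum.inr l) : O F p t) = -pd (Sum.inl l) := by
  refine LinearMap.ext fun f => ?_
  rw [T_apply (parity_var (Sum.inr l)), Finset.sum_eq_single l]
  · rw [pd_var, pd_var, if_pos rfl, if_neg (by simp), one_mul']
    simp [parity, koszul_one_one]
  · intro j _ hj
    rw [pd_var, pd_var, if_neg (by simp [hj]), if_neg (by simp)]
    simp
  · simp

theorem T_var_inl [Fact p.Prime] {i : ZMod 2} {a : O F p t} (ha : a ∈ homog F i) (j : Fin m) :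
    T a (var (Sum.inl j)) = koszul 1 i • pd (Sum.inr j) a := by
  rw [T_eq_op ha, op_var]
  rfl

theorem T_var_inr [Fact p.Prime] {i : ZMod 2} {a : O F p t} (ha : a ∈ homog F i) (j : Fin m) :
    T a (var (Sum.inr j)) = pd (Sum.inl j) a := by
  rw [T_eq_op ha, op_var]
  simp [parity, koszul_zero_left]

theorem koszul_smul_eq_zero {M : Type*} [AddCommGroup M] {i j : ZMod 2} {x : M}
    (h : koszul i j • x = 0) : x = 0 := by
  have := congrArg (koszul i j • ·) h
  simpa [smul_smul, koszul_mul_self] using this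

/-- The kernel of `T` consists of elements annihilated by all partial derivations. -/
theorem pd_eq_zero_of_T_eq_zero [Fact p.Prime] {i : ZMod 2} {a : O F p t} (ha : a ∈ homog F i)
    (h : T a = 0) (r : Y m) : pd r a = 0 := by
  rcases r with j | j
  · rw [← T_var_inr ha, h, LinearMap.zero_apply]
  · refine koszul_smul_eq_zero (i := 1) (j := i) ?_
    rw [← T_var_inl ha, h, LinearMap.zero_apply]

theorem pd_eq_of_T_eq [Fact p.Prime] {i : ZMod 2} {a b : O F p t} (ha : a ∈ homog F i)
    (hb : b ∈ homog F i) (h : T a = T b) (r : Y m) : pd r a = pd r b := by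
  have := pd_eq_zero_of_T_eq_zero (Submodule.sub_mem _ ha hb) (by rw [map_sub, h, sub_self]) r
  rwa [map_sub, sub_eq_zero] at this

/-- The odd Laplacian `∑ i, ∂_i ∂_{i'}`. On Hamiltonian operators `T a` the divergence is, up to
the factor `± 2`, the Laplacian of `a`. -/
noncomputable def lap : Module.End F (O F p t) :=
  ∑ j : Fin m, pd (Sum.inl j) * pd (Sum.inr j)

theorem lap_apply (a : O F p t) : lap a = ∑ j : Fin m, pd (Sum.inl j) (pd (Sum.inr j) a) := by
  simp [lap]

theorem div_T [Fact p.Prime] {i : ZMod 2} {a : O F p t} (ha : a ∈ homog F i) :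
    div (T a) = (2 * koszul 1 i) • lap a := by
  rw [T_eq_op ha, div_op (coef_T_mem ha), Fintype.sum_sum_type, lap_apply, mul_smul, two_smul,
    Finset.smul_sum]
  have e : i + 1 + 1 = i := by clear ha; revert i; decide
  congr 1 <;> refine Finset.sum_congr rfl fun j _ => ?_
  · simp [parity, koszul_zero_left]
  · rw [pd_comm]
    simp [parity, koszul_zero_left, e]

theorem T_mem_SHO [Fact p.Prime] [CharP F p] {i : ZMod 2} {a : O F p t} (ha : a ∈ homog F i)
    (h : lap a = 0) : T a ∈ (SHO F p t).carrier := by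
  have h1 : T a ∈ HO F p t := ⟨a, rfl⟩
  refine ⟨⟨HO_le_W h1, ?_⟩, h1⟩
  rw [SetLike.mem_coe, LinearMap.mem_ker, div_T ha, h, smul_zero]

theorem lap_eq_zero [Fact p.Prime] [CharP F p] (hp : p ≠ 2) {i : ZMod 2} {a : O F p t}
    (ha : a ∈ homog F i) (h : T a ∈ (SHO F p t).carrier) : lap a = 0 := by
  have h1 : div (T a) = 0 := LinearMap.mem_ker.1 h.1.2
  rw [div_T ha, mul_comm, mul_smul] at h1
  have h2 := koszul_smul_eq_zero h1
  rw [← Int.cast_smul_eq_zsmul F, smul_eq_zero] at h2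
  refine h2.resolve_left ?_
  have : ((2 : ℕ) : F) ≠ 0 := by
    rw [Ne, CharP.cast_eq_zero_iff F p, Nat.prime_dvd_prime_iff_eq Fact.out Nat.prime_two]
    exact hp
  simpa using this

/-! ### Elements of the derived algebras -/

theorem T_pd_inr_mem_derived [Fact p.Prime] [CharP F p]
    {K : LieSubsuperalgebra F (Module.End F (O F p t))} {l : Fin m} {a : O F p t}
    (hl : T (var (Sum.inl l)) ∈ K.carrier) (ha : T a ∈ K.carrier) :
    T (pd (Sum.inr l) a) ∈ K.derived.carrier := by
  have h := K.br_mem_derived hl ha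
  have e : SuperEnd.bracket (T (var (Sum.inl l))) (T a) = T (pd (Sum.inr l) a) := by
    rw [bracket_T, T_inl_var]
  rw [← e]
  exact h

/-- A monomial is, up to sign, the bracket of `x_l` with its product by `x_{l'}`. -/
theorem T_mono_mem_derived [Fact p.Prime] [CharP F p]
    {K : LieSubsuperalgebra F (Module.End F (O F p t))} {l : Fin m} {α : Fin m → ℕ}
    {u : Finset (Fin m)} (hlu : l ∉ u) (hl : T (var (Sum.inl l)) ∈ K.carrier)
    (ha : T (mono α (insert l u)) ∈ K.carrier) : T (mono α u) ∈ K.derived.carrier := by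
  have h := T_pd_inr_mem_derived hl ha
  rw [pd_inr_mono, if_pos (Finset.mem_insert_self _ _), Finset.erase_insert hlu, map_smul] at h
  have h2 := Submodule.smul_mem _ ((-1 : F) ^ ((insert l u).filter fun j => j < l).card) h
  rwa [smul_smul, ← mul_pow, neg_one_mul, neg_neg, one_pow, one_smul] at h2

variable [Fact p.Prime] [CharP F p]

theorem T_mono_mem_SHO {α : Fin m → ℕ} {u : Finset (Fin m)} (h : ∀ i ∈ u, α i = 0) :
    T (mono α u : O F p t) ∈ (SHO F p t).carrier := by
  refine T_mem_SHO (mono_mem α u) ?_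
  by_cases hα : ∀ i, α i < p ^ (t i : ℕ)
  · rw [lap_apply]
    refine Finset.sum_eq_zero fun j _ => ?_
    rw [pd_inr_mono]
    split_ifs with hj
    · rw [map_smul, pd_inl_mono hα, if_pos (h j hj), smul_zero]
    · rw [map_zero]
  · rw [mono_of_not_lt hα, map_zero]

theorem T_mono_mem_SHO_derived {α : Fin m → ℕ} {u : Finset (Fin m)} (h : ∀ i ∈ u, α i = 0)
    {l : Fin m} (hlu : l ∉ u) (hl : α l = 0) :
    T (mono α u : O F p t) ∈ (SHO F p t).derived.carrier := by
  refine T_mono_mem_derived hlu (T_mono_mem_SHO (by simp)) (T_mono_mem_SHO ?_)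
  simpa [hl] using h

theorem T_mono_mem_SHO2 {α : Fin m → ℕ} {u : Finset (Fin m)} (h : ∀ i ∈ u, α i = 0)
    {k l : Fin m} (hkl : k ≠ l) (hku : k ∉ u) (hk : α k = 0) (hlu : l ∉ u) (hl : α l = 0) :
    T (mono α u : O F p t) ∈ (SHO2 F p t).carrier := by
  refine T_mono_mem_derived hlu ?_ ?_
  · exact T_mono_mem_SHO_derived (l := k) (by simp) (by simp) (by simp [hkl])
  · refine T_mono_mem_SHO_derived (l := k) ?_ (by simp [hkl, hku]) hk
    simpa [hl] using h

theorem exists_ne_ne (hm : 3 ≤ m) (i j : Fin m) : ∃ k, k ≠ i ∧ k ≠ j := by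
  obtain ⟨k, hk⟩ := Finset.exists_mem_notMem_of_card_lt_card (s := {i, j}) (t := Finset.univ)
    (lt_of_le_of_lt Finset.card_le_two (by simpa using Nat.lt_of_succ_le hm))
  simp at hk
  exact ⟨k, hk⟩

theorem T_mono_single_mem_SHO2 (hm : 3 ≤ m) (i : Fin m) (n : ℕ) :
    T (mono (Pi.single i n) ∅ : O F p t) ∈ (SHO2 F p t).carrier := by
  obtain ⟨k, hk, -⟩ := exists_ne_ne hm i i
  obtain ⟨l, hl, hlk⟩ := exists_ne_ne hm i k
  exact T_mono_mem_SHO2 (by simp) hlk.symm (by simp) (by simp [hk]) (by simp) (by simp [hl])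

theorem T_inr_var_mem_SHO2 (hm : 3 ≤ m) (i : Fin m) :
    T (var (Sum.inr i) : O F p t) ∈ (SHO2 F p t).carrier := by
  obtain ⟨k, hk, -⟩ := exists_ne_ne hm i i
  obtain ⟨l, hl, hlk⟩ := exists_ne_ne hm i k
  exact T_mono_mem_SHO2 (by simp) hlk.symm (by simpa using hk) (by simp) (by simpa using hl)
    (by simp)

/-- The toral elements `x_k x_{k'} - x_j x_{j'}` are brackets of `x_j x_{k'}` and `x_k x_{j'}`. -/
theorem T_toral_mem_SHO2 (hm : 3 ≤ m) (j k : Fin m) :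
    T (mono (Pi.single k 1) {k} - mono (Pi.single j 1) {j} : O F p t) ∈
      (SHO2 F p t).carrier := by
  by_cases hjk : j = k
  · subst hjk
    rw [sub_self, map_zero]
    exact Submodule.zero_mem _
  obtain ⟨l, hl, hlk⟩ := exists_ne_ne hm j k
  have h1 : T (mono (Pi.single j 1) {k} : O F p t) ∈ (SHO F p t).derived.carrier :=
    T_mono_mem_SHO_derived (l := l) (by simp [Ne.symm hjk]) (by simpa using hlk) (by simp [hl])
  have h2 : T (mono (Pi.single k 1) {j} : O F p t) ∈ (SHO F p t).derived.carrier :=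
    T_mono_mem_SHO_derived (l := l) (by simp [hjk]) (by simpa using hl) (by simp [hlk])
  have hlt : ∀ i : Fin m, ∀ j, (Pi.single i 1 : Fin m → ℕ) j < p ^ (t j : ℕ) := fun i j =>
    lt_of_le_of_lt (by by_cases h : j = i <;> simp [h])
      (Nat.one_lt_pow (t j).ne_zero (Fact.out : p.Prime).one_lt)
  have e : T (mono (Pi.single j 1) {k} : O F p t) (mono (Pi.single k 1) {j}) =
      mono (Pi.single k 1) {k} - mono (Pi.single j 1) {j} := by
    have hodd : (mono (Pi.single j 1) {k} : O F p t) ∈ homog F 1 := by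
      simpa using mono_mem (F := F) (p := p) (t := t) (Pi.single j 1) {k}
    rw [T_apply hodd, Finset.sum_add_distrib, Finset.sum_eq_single k, Finset.sum_eq_single j]
    · rw [pd_inr_mono, pd_inr_mono, pd_inl_mono (hlt _), pd_inl_mono (hlt _)]
      simp [koszul_one_one, mul_mono, inv, Finset.filter_singleton]
      abel
    · intro i _ hi
      simp [pd_inl_mono (hlt _), hi]
    · simp
    · intro i _ hi
      simp [pd_inr_mono, hi]
    · simp
  rw [← e, ← bracket_T]
  exact LieSubsuperalgebra.br_mem_derived _ h1 h2

end OddHam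

namespace OddHam

open SuperSpace LieSuperalgebra

variable {F : Type*} [Field F] {p m : ℕ} {t : Fin m → ℕ+}

/-! ### Even Hamiltonian operators and divided powers of one variable -/

theorem T_mem_homog_zero {a : O F p t} (ha : a ∈ homog F 1) : T a ∈ homog F 0 := by
  have := T_mem_homog ha
  rwa [show (1 : ZMod 2) + 1 = 0 by decide] at this

/-- Even elements of the odd Hamiltonian superalgebra come from odd elements of `O(m, m; t)`. -/
theorem exists_odd_of_mem_HO {D : Module.End F (O F p t)} (h : D ∈ HO F p t)
    (h0 : D ∈ homog F 0) : ∃ a ∈ homog (V := O F p t) F 1, D = T a := by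
  obtain ⟨a, rfl⟩ := h
  refine ⟨proj (F := F) 1 a, proj_mem _ _, ?_⟩
  have := proj_T (0 : ZMod 2) a
  rwa [mem_homog.1 h0, zero_add] at this

variable [Fact p.Prime]

theorem pd_one (r : Y m) : pd r (mono 0 ∅ : O F p t) = 0 := by
  rcases r with r | r
  · rw [pd_inl_mono (α := 0) fun _ => pow_pos (Fact.out : p.Prime).pos _]
    simp
  · rw [pd_inr_mono]
    simp

theorem single_lt {i : Fin m} {n : ℕ} (hn : n < p ^ (t i : ℕ)) (j : Fin m) :
    (Pi.single i n : Fin m → ℕ) j < p ^ (t j : ℕ) := by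
  by_cases h : j = i
  · subst h
    simpa using hn
  · simpa [h] using pow_pos (Fact.out : p.Prime).pos _

theorem pd_inl_mono_single (i : Fin m) {n : ℕ} (hn : n + 1 < p ^ (t i : ℕ)) :
    pd (Sum.inl i) (mono (Pi.single i (n + 1)) ∅ : O F p t) = mono (Pi.single i n) ∅ := by
  rw [pd_inl_mono (single_lt hn), if_neg (by simp)]
  congr 1
  ext j
  by_cases h : j = i <;> simp [h]

theorem pd_inl_pow_mono_single (i : Fin m) (n k : ℕ) (h : n + k < p ^ (t i : ℕ)) :
    (pd (Sum.inl i) ^ n) (mono (Pi.single i (n + k)) ∅ : O F p t) =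
      mono (Pi.single i k) ∅ := by
  induction n with
  | zero => simp
  | succ n ih =>
    rw [pow_succ, Module.End.mul_apply, show n + 1 + k = n + k + 1 by omega,
      pd_inl_mono_single i (by omega), ih (by omega)]

theorem T_mono_single (i : Fin m) {n : ℕ} (hn : n + 1 < p ^ (t i : ℕ)) {a : O F p t}
    (ha : a ∈ homog F 1) :
    T a (mono (Pi.single i (n + 1)) ∅) =
      -mul (pd (Sum.inr i) a) (mono (Pi.single i n) ∅) := by
  rw [T_apply ha, Finset.sum_eq_single i]
  · rw [pd_inl_mono_single i hn, pd_inr_mono, koszul_one_one]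
    simp
  · intro j _ hj
    rw [pd_inl_mono (single_lt hn), pd_inr_mono, if_pos (by simp [hj])]
    simp
  · simp

variable [CharP F p]

theorem SHO2_le_SHO : (SHO2 F p t).carrier ≤ (SHO F p t).carrier :=
  LieSubsuperalgebra.derived_le _ |>.trans (LieSubsuperalgebra.derived_le _)

theorem iterate_bracket_T (c b : O F p t) (n : ℕ) :
    (SuperEnd.bracket (T c))^[n] (T b) = T ((T c ^ n) b) := by
  induction n with
  | zero => simp
  | succ n ih =>
    rw [Function.iterate_succ_apply', ih, bracket_T, pow_succ', Module.End.mul_apply]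

/-! ### Necessity: the translations `∂_i` -/

/-- In a restricted subalgebra of Hamiltonian operators the `p`-th power of an even element acts on
the subalgebra as a Hamiltonian operator. -/
theorem exists_T_eq_pow_of_isRestricted {K : LieSubsuperalgebra F (Module.End F (O F p t))}
    (hK : K.carrier ≤ HO F p t) (h : IsRestricted F K.carrier p)
    {c : O F p t} (hc : c ∈ homog F 1) (hT : T c ∈ K.carrier) :
    ∃ a ∈ homog (V := O F p t) F 1, ∀ b, T b ∈ K.carrier → T (T a b) = T ((T c ^ p) b) := by
  obtain ⟨D, hD, hD0, hbr⟩ := K.exists_br_eq_iterate_of_isRestricted h hT (T_mem_homog_zero hc)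
  obtain ⟨a, ha, rfl⟩ := exists_odd_of_mem_HO (hK hD) hD0
  refine ⟨a, ha, fun b hb => ?_⟩
  have h1 : SuperEnd.bracket (T a) (T b) = (SuperEnd.bracket (T c))^[p] (T b) := hbr _ hb
  rwa [iterate_bracket_T, bracket_T] at h1

/-- If `∂_i ^ p` acts on `SHO(m, m; t)^(2)` as some `T a`, then by its action on the elements
`T x_j` the function `q = ∂_{i'} a` is constant, and, for `t i > 1`, by its action on `T x_i^(p+1)`
it satisfies `q x_i^(p-1) = 1`, which is absurd. -/
theorem eq_one_of_isRestricted (hp : p ≠ 2) (hm : 3 ≤ m)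
    (h : IsRestricted F (SHO2 F p t).carrier p) (i : Fin m) : t i = 1 := by
  have hp3 : 3 ≤ p := lt_of_le_of_ne (Fact.out : p.Prime).two_le hp.symm
  by_contra hti
  have hlt : p + 1 < p ^ (t i : ℕ) := by
    have h2 : 2 ≤ (t i : ℕ) := by
      have h3 : (t i : ℕ) ≠ 1 := fun h => hti (PNat.eq h)
      have := (t i).pos
      omega
    calc p + 1 < p * p := by nlinarith
      _ = p ^ 2 := (sq p).symm
      _ ≤ _ := Nat.pow_le_pow_right (by omega) h2
  obtain ⟨a, ha, key⟩ := exists_T_eq_pow_of_isRestricted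
    (fun _ hx => (SHO2_le_SHO hx).2) h (parity_var (Sum.inr i))
    (T_inr_var_mem_SHO2 hm i)
  rw [T_inr_var, ((Fact.out : p.Prime).odd_of_ne_two hp).neg_pow] at key
  set q := pd (Sum.inr i) a with hq
  have hq0 : q ∈ homog F 0 := pd_apply_mem ha (Sum.inr i)
  have hconst : ∀ r, pd r q = 0 := by
    have e : ((pd (Sum.inl i) ^ p) (var (Sum.inl i)) : O F p t) = 0 := by
      have e2 : (pd (Sum.inl i) ^ p : Module.End F (O F p t)) =
          pd (Sum.inl i) ^ (p - 2) * pd (Sum.inl i) * pd (Sum.inl i) := by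
        rw [mul_assoc, ← sq, ← pow_add, Nat.sub_add_cancel (by omega)]
      rw [e2, Module.End.mul_apply, Module.End.mul_apply, pd_var, if_pos rfl, pd_one, map_zero]
    have h1 := key (var (Sum.inl i)) (T_mono_single_mem_SHO2 hm i 1)
    rw [LinearMap.neg_apply, e, T_var_inl ha, neg_zero,
      map_zero, koszul_one_one, neg_one_smul, map_neg, neg_eq_zero] at h1
    exact pd_eq_zero_of_T_eq_zero hq0 h1
  have hmul : ∀ n, n + 1 < p ^ (t i : ℕ) → pd (Sum.inl i) (mul q (mono (Pi.single i (n + 1)) ∅)) =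
      mul q (mono (Pi.single i n) ∅) := by
    intro n hn
    rw [pd_mul _ hq0, hconst, koszul_zero_right, pd_inl_mono_single i hn]
    simp
  have h2 := key _ (T_mono_single_mem_SHO2 hm i (p + 1))
  rw [LinearMap.neg_apply, pd_inl_pow_mono_single i p 1 hlt, T_mono_single i hlt ha, map_neg,
    map_neg, neg_inj] at h2
  have hev : ∀ n, (mono (Pi.single i n) ∅ : O F p t) ∈ homog F 0 := fun n => by
    simpa using mono_mem (F := F) (p := p) (t := t) (Pi.single i n) ∅
  have h3 : pd (Sum.inl i) _ = pd (Sum.inl i) (var (Sum.inl i)) :=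
    pd_eq_of_T_eq (mul_mem hq0 (hev p)) (hev 1) h2 (Sum.inl i)
  obtain ⟨n, rfl⟩ : ∃ n, p = n + 2 := ⟨p - 2, by omega⟩
  rw [hmul (n + 1) (by omega), pd_var, if_pos rfl] at h3
  have h4 := congrArg (pd (Sum.inl i)) h3
  rw [hmul n (by omega), pd_one] at h4
  -- multiplying `q x_i^(p-2) = 0` by `x_i` recovers `(p - 1) q x_i^(p-1) = 0`
  have h5 := congrArg (fun f => mul f (mono (Pi.single i 1) ∅)) h4
  simp only [mul_assoc', mul_mono, map_zero, LinearMap.zero_apply] at h5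
  have hprod : ∏ j, ((Pi.single i n : Fin m → ℕ) j + (Pi.single i 1 : Fin m → ℕ) j).choose
      ((Pi.single i n : Fin m → ℕ) j) = n + 1 := by
    rw [Finset.prod_eq_single i]
    · simp
    · intro j _ hj
      simp [hj]
    · simp
  rw [if_pos (Finset.disjoint_empty_left _), hprod, ← Pi.single_add, Finset.union_empty, map_smul,
    h3, smul_eq_zero] at h5
  have hn : ((n + 1 : ℕ) : F) ≠ 0 := by
    rw [Ne, CharP.cast_eq_zero_iff F (n + 2)]
    exact fun hd => absurd (Nat.le_of_dvd (by omega) hd) (by omega)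
  exact h5.elim (by simpa [inv] using hn) mono_zero_ne_zero

end OddHam

namespace OddHam

open SuperSpace LieSuperalgebra

variable {F : Type*} [Field F] {p m : ℕ} {t : Fin m → ℕ+}

/-! ### The weight grading -/

/-- The weight of the monomial `x^(α) x^u`: the variable `x_i` has weight `ε_i` and `x_{i'}` has
weight `-ε_i`, so that the bracket `T a b` has weight zero. -/
def weight (α : Fin m → ℕ) (u : Finset (Fin m)) : Fin m → ℤ :=
  fun i => α i - if i ∈ u then 1 else 0

variable (F p t) in
/-- The span of the monomials of weight `γ`. -/
noncomputable def wtSpace (γ : Fin m → ℤ) : Submodule F (O F p t) :=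
  Submodule.span F {f | ∃ α u, (∀ i, α i < p ^ (t i : ℕ)) ∧ weight α u = γ ∧ f = mono α u}

/-- The projection onto `wtSpace F p t γ`. -/
noncomputable def wtProj (γ : Fin m → ℤ) : Module.End F (O F p t) :=
  lift fun a => if weight a.1.1 a.2 = γ then bas a else 0

theorem wtProj_mono (γ : Fin m → ℤ) (α : Fin m → ℕ) (u : Finset (Fin m)) :
    wtProj γ (mono α u : O F p t) = if weight α u = γ then mono α u else 0 := by
  by_cases hα : ∀ i, α i < p ^ (t i : ℕ)
  · rw [mono_of_lt hα]
    exact lift_bas _ _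
  · simp [mono_of_not_lt hα]

theorem mono_mem_wtSpace (α : Fin m → ℕ) (u : Finset (Fin m)) :
    (mono α u : O F p t) ∈ wtSpace F p t (weight α u) := by
  by_cases hα : ∀ i, α i < p ^ (t i : ℕ)
  · exact Submodule.subset_span ⟨α, u, hα, rfl, rfl⟩
  · rw [mono_of_not_lt hα]
    exact Submodule.zero_mem _

theorem wtSpace_induction {γ : Fin m → ℤ} {P : O F p t → Prop} (h0 : P 0)
    (hadd : ∀ f g, P f → P g → P (f + g)) (hsmul : ∀ (c : F) f, P f → P (c • f))
    (hm : ∀ (α : Fin m → ℕ) (_ : ∀ i, α i < p ^ (t i : ℕ)) (u : Finset (Fin m)),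
      weight α u = γ → P (mono α u)) {f : O F p t} (hf : f ∈ wtSpace F p t γ) : P f := by
  refine Submodule.span_induction (p := fun f _ => P f) ?_ h0 (fun f g _ _ => hadd f g)
    (fun c f _ => hsmul c f) hf
  rintro _ ⟨α, u, hα, hw, rfl⟩
  exact hm α hα u hw

theorem wtProj_mem (γ : Fin m → ℤ) (f : O F p t) : wtProj γ f ∈ wtSpace F p t γ := by
  induction f using mono_induction with
  | h0 => simp
  | hadd a b ha hb => rw [map_add]; exact Submodule.add_mem _ ha hb
  | hm c α _ u =>
    rw [map_smul, wtProj_mono]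
    refine Submodule.smul_mem _ _ ?_
    split_ifs with h
    · rw [← h]; exact mono_mem_wtSpace α u
    · exact Submodule.zero_mem _

theorem wtProj_mem_homog {i : ZMod 2} {f : O F p t} (hf : f ∈ homog F i) (γ : Fin m → ℤ) :
    wtProj γ f ∈ homog F i := by
  refine homog_induction (P := fun f => wtProj γ f ∈ homog F i) (by simp)
    (fun a b ha hb => by rw [map_add]; exact Submodule.add_mem _ ha hb) ?_ hf
  intro c α _ u hu
  rw [map_smul, wtProj_mono]
  refine Submodule.smul_mem _ _ ?_
  split_ifs
  · rw [← hu]; exact mono_mem α u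
  · exact Submodule.zero_mem _

theorem exists_sum_wtProj (f : O F p t) :
    ∃ s : Finset (Fin m → ℤ), ∀ s', s ⊆ s' → ∑ γ ∈ s', wtProj γ f = f := by
  classical
  induction f using mono_induction with
  | h0 => exact ⟨∅, by simp⟩
  | hadd a b ha hb =>
    obtain ⟨s, hs⟩ := ha
    obtain ⟨s', hs'⟩ := hb
    refine ⟨s ∪ s', fun r hr => ?_⟩
    simp only [map_add, Finset.sum_add_distrib]
    rw [hs r (Finset.union_subset_left hr), hs' r (Finset.union_subset_right hr)]
  | hm c α _ u =>
    refine ⟨{weight α u}, fun r hr => ?_⟩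
    simp only [map_smul, wtProj_mono, ← Finset.smul_sum]
    rw [Finset.sum_ite_eq, if_pos (hr (Finset.mem_singleton_self _))]

/-- The weight of the partial derivation `∂_r`. -/
def pdWeight : Y m → Fin m → ℤ
  | Sum.inl j => Pi.single j (-1)
  | Sum.inr j => Pi.single j 1

theorem pdWeight_swap (r : Y m) : pdWeight r.swap + pdWeight r = 0 := by
  rcases r with r | r <;> simp [pdWeight, ← Pi.single_add]

theorem weight_erase (α : Fin m → ℕ) {u : Finset (Fin m)} {j : Fin m} (hj : j ∈ u) :
    weight α (u.erase j) = weight α u + Pi.single j 1 := by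
  ext i
  by_cases h : i = j
  · subst h; simp [weight, hj]
  · simp [weight, h]

theorem weight_sub_single {α : Fin m → ℕ} {j : Fin m} (hj : α j ≠ 0) (u : Finset (Fin m)) :
    weight (α - Pi.single j 1) u = weight α u + Pi.single j (-1) := by
  ext i
  by_cases h : i = j
  · subst h
    simp only [weight, Pi.sub_apply, Pi.single_eq_same, Pi.add_apply]
    omega
  · simp [weight, h]

theorem pd_mem_wtSpace {γ : Fin m → ℤ} {f : O F p t} (hf : f ∈ wtSpace F p t γ) (r : Y m) :
    pd r f ∈ wtSpace F p t (γ + pdWeight r) := by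
  refine wtSpace_induction (P := fun f => pd r f ∈ wtSpace F p t (γ + pdWeight r)) (by simp)
    (fun a b ha hb => by rw [map_add]; exact Submodule.add_mem _ ha hb)
    (fun c a ha => by rw [map_smul]; exact Submodule.smul_mem _ _ ha) ?_ hf
  rintro α hα u rfl
  rcases r with r | r
  · rw [pd_inl_mono hα]
    split_ifs with h
    · exact Submodule.zero_mem _
    · rw [pdWeight, ← weight_sub_single h]
      exact mono_mem_wtSpace _ _
  · rw [pd_inr_mono]
    split_ifs with h
    · rw [pdWeight, ← weight_erase α h]
      exact Submodule.smul_mem _ _ (mono_mem_wtSpace _ _)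
    · exact Submodule.zero_mem _

theorem wtProj_lap (γ : Fin m → ℤ) (f : O F p t) : wtProj γ (lap f) = lap (wtProj γ f) := by
  induction f using mono_induction with
  | h0 => simp
  | hadd a b ha hb => simp only [map_add, ha, hb]
  | hm c α hα u =>
    rw [map_smul, map_smul, map_smul, map_smul]
    congr 1
    rw [wtProj_mono, lap_apply, map_sum]
    have key : ∀ j : Fin m, wtProj γ (pd (Sum.inl j) (pd (Sum.inr j) (mono α u : O F p t))) =
        if weight α u = γ then pd (Sum.inl j) (pd (Sum.inr j) (mono α u)) else 0 := by
      intro j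
      rw [pd_inr_mono]
      split_ifs with hj h h
      · rw [map_smul, map_smul, pd_inl_mono hα]
        split_ifs with h0
        · simp
        · rw [wtProj_mono, weight_sub_single h0, weight_erase α hj, add_assoc, ← Pi.single_add]
          simp [h]
      · rw [map_smul, map_smul, pd_inl_mono hα]
        split_ifs with h0
        · simp
        · rw [wtProj_mono, weight_sub_single h0, weight_erase α hj, add_assoc, ← Pi.single_add]
          simp [h]
      · simp
      · simp
    simp only [key]
    split_ifs
    · rw [lap_apply]
    · simp

theorem mul_mem_wtSpace {γ δ : Fin m → ℤ} {f g : O F p t} (hf : f ∈ wtSpace F p t γ)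
    (hg : g ∈ wtSpace F p t δ) : mul f g ∈ wtSpace F p t (γ + δ) := by
  refine wtSpace_induction (P := fun f => mul f g ∈ wtSpace F p t (γ + δ)) (by simp)
    (fun a b ha hb => by rw [map_add]; exact Submodule.add_mem _ ha hb)
    (fun c a ha => by rw [map_smul]; exact Submodule.smul_mem _ _ ha) ?_ hf
  rintro α - u rfl
  refine wtSpace_induction (P := fun g => mul (mono α u) g ∈ wtSpace F p t (weight α u + δ))
    (by simp) (fun a b ha hb => by rw [map_add]; exact Submodule.add_mem _ ha hb)
    (fun c a ha => by rw [map_smul]; exact Submodule.smul_mem _ _ ha) ?_ hg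
  rintro β - v rfl
  rw [mul_mono]
  split_ifs with h
  · have e : weight α u + weight β v = weight (α + β) (u ∪ v) := by
      ext i
      by_cases hu : i ∈ u
      · have hv : i ∉ v := Finset.disjoint_left.1 h hu
        simp [weight, hu, hv]
        ring
      · simp [weight, hu]
        ring
    rw [e]
    exact Submodule.smul_mem _ _ (mono_mem_wtSpace _ _)
  · exact Submodule.zero_mem _

theorem T_apply_mem_wtSpace {γ δ : Fin m → ℤ} {i : ZMod 2} {a f : O F p t} (hi : a ∈ homog F i)
    (ha : a ∈ wtSpace F p t γ) (hf : f ∈ wtSpace F p t δ) : T a f ∈ wtSpace F p t (γ + δ) := by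
  rw [T_eq_op hi, op_apply]
  refine Submodule.sum_mem _ fun r _ => ?_
  rw [zsmul_mul]
  refine zsmul_mem ?_ _
  have := mul_mem_wtSpace (pd_mem_wtSpace ha r.swap) (pd_mem_wtSpace hf r)
  rwa [add_add_add_comm, pdWeight_swap, add_zero] at this

theorem eq_zero_of_mem_wtSpace {γ : Fin m → ℤ} {f : O F p t} (hf : f ∈ wtSpace F p t γ)
    (i : Fin m) (hi : γ i < -1 ∨ ((p ^ (t i : ℕ) : ℕ) : ℤ) ≤ γ i) : f = 0 := by
  refine wtSpace_induction (P := fun f => f = 0) rfl (fun a b ha hb => by rw [ha, hb, add_zero])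
    (fun c a ha => by rw [ha, smul_zero]) ?_ hf
  rintro α hα u rfl
  exfalso
  have := hα i
  simp only [weight] at hi
  split_ifs at hi <;> omega

/-! ### Weight homogeneous spanning sets of the derived algebras -/

/-- The elements of `K` of the form `T a` with `a` homogeneous for both the parity and the
weight. -/
def homogElements (K : LieSubsuperalgebra F (Module.End F (O F p t))) :
    Set (Module.End F (O F p t)) :=
  {x | x ∈ K.carrier ∧ ∃ γ i, ∃ a ∈ wtSpace F p t γ, a ∈ homog F i ∧ x = T a}

variable [Fact p.Prime] [CharP F p]

/-- The bracket `[T a, T b] = T (T a b)` is homogeneous when `a` and `b` are, so the grading passes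
to derived algebras. -/
theorem derived_le_span_homogElements {K : LieSubsuperalgebra F (Module.End F (O F p t))}
    (h : K.carrier ≤ Submodule.span F (homogElements K)) :
    K.derived.carrier ≤ Submodule.span F (homogElements K.derived) := by
  refine Submodule.span_le.2 ?_
  rintro _ ⟨x, hx, y, hy, rfl⟩
  have h1 := Submodule.apply_mem_map₂ (SuperEnd.bracket (F := F) (V := O F p t)) (h hx) (h hy)
  rw [Submodule.map₂_span_span] at h1
  refine Submodule.span_mono ?_ h1
  rintro _ ⟨_, ⟨hx, γ, i, a, ha, hai, rfl⟩, _, ⟨hy, δ, j, b, hb, hbj, rfl⟩, rfl⟩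
  exact ⟨K.br_mem_derived hx hy, γ + δ, j + (i + 1), T a b, T_apply_mem_wtSpace hai ha hb,
    apply_mem (T_mem_homog hai) hbj, bracket_T a b⟩

/-- The grading of `SHO`: the Laplacian commutes with the projections onto weight spaces. -/
theorem SHO_le_span_homogElements (hp : p ≠ 2) :
    (SHO F p t).carrier ≤ Submodule.span F (homogElements (SHO F p t)) := by
  intro x hx
  obtain ⟨a, rfl⟩ := hx.2
  have ha : ∀ i, T (proj (F := F) i a) ∈ (SHO F p t).carrier := by
    intro i
    have := (SHO F p t).proj_mem (i + 1) _ hx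
    rwa [proj_T, show i + 1 + 1 = i by clear this; revert i; decide] at this
  rw [← sum_proj (F := F) a, map_sum]
  refine Submodule.sum_mem _ fun i _ => ?_
  have hi := proj_mem (F := F) i a
  obtain ⟨s, hs⟩ := exists_sum_wtProj (proj (F := F) i a)
  rw [← hs s subset_rfl, map_sum]
  refine Submodule.sum_mem _ fun γ _ => Submodule.subset_span ⟨T_mem_SHO (wtProj_mem_homog hi γ) ?_,
    γ, i, _, wtProj_mem _ _, wtProj_mem_homog hi γ, rfl⟩
  rw [← wtProj_lap, lap_eq_zero hp hi (ha i), map_zero]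

theorem SHO2_le_span_homogElements (hp : p ≠ 2) :
    (SHO2 F p t).carrier ≤ Submodule.span F (homogElements (SHO2 F p t)) :=
  derived_le_span_homogElements (derived_le_span_homogElements (SHO_le_span_homogElements hp))

end OddHam

namespace OddHam

open SuperSpace LieSuperalgebra

variable {F : Type*} [Field F] {p m : ℕ} {t : Fin m → ℕ+}

/-! ### Coefficients and Euler identities -/

/-- The coefficient of a basis monomial. -/
noncomputable def coef (b : Box p t × Finset (Fin m)) : O F p t →ₗ[F] F := Finsupp.lapply b

theorem eq_zero_of_coef {f : O F p t} (h : ∀ b, coef b f = 0) : f = 0 := Finsupp.ext h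

theorem coef_mono (b : Box p t × Finset (Fin m)) {α : Fin m → ℕ}
    (hα : ∀ i, α i < p ^ (t i : ℕ)) (u : Finset (Fin m)) :
    coef b (mono α u : O F p t) = if α = b.1.1 ∧ u = b.2 then 1 else 0 := by
  classical
  rw [mono_of_lt hα]
  refine (Finsupp.single_apply (a := (⟨α, hα⟩, u)) (a' := b) (b := (1 : F))).trans ?_
  simp only [Prod.ext_iff, Subtype.ext_iff]

/-- An odd element annihilated by all odd derivations vanishes. -/
theorem eq_zero_of_pd_inr {f : O F p t} (hf : f ∈ homog F 1)
    (h : ∀ j, pd (Sum.inr j) f = 0) : f = 0 := by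
  refine eq_zero_of_coef fun b => ?_
  rcases b.2.eq_empty_or_nonempty with hb | ⟨j, hj⟩
  · refine homog_induction (P := fun f => coef b f = 0) (by simp)
      (fun a b ha hb => by rw [map_add, ha, hb, add_zero]) ?_ hf
    intro c α hα u hu
    rw [map_smul, coef_mono b hα, if_neg, smul_zero]
    rintro ⟨-, rfl⟩
    rw [hb] at hu
    simp at hu
  · have key : ∀ g : O F p t, coef b g = (-1) ^ (b.2.filter fun i => i < j).card *
        coef (b.1, b.2.erase j) (pd (Sum.inr j) g) := by
      intro g
      induction g using mono_induction with
      | h0 => simp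
      | hadd a b ha hb => simp only [map_add, ha, hb, mul_add]
      | hm c α hα u =>
        rw [map_smul, map_smul, map_smul, coef_mono b hα, pd_inr_mono, smul_eq_mul, smul_eq_mul,
          mul_left_comm]
        congr 1
        split_ifs with h1 h2 h2
        · obtain ⟨rfl, rfl⟩ := h1
          rw [map_smul, coef_mono _ hα, if_pos ⟨rfl, rfl⟩, smul_eq_mul, mul_one, ← mul_pow]
          simp
        · exact absurd (h1.2 ▸ hj) h2
        · rw [map_smul, coef_mono _ hα, if_neg, smul_zero, mul_zero]
          rintro ⟨h3, h4⟩
          refine h1 ⟨h3, ?_⟩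
          rw [← Finset.insert_erase h2, ← Finset.insert_erase hj]
          exact congrArg _ h4
        · simp
    rw [key, h, map_zero, mul_zero]

theorem mul_var_inl_pd (i : Fin m) {α : Fin m → ℕ} (hα : ∀ i, α i < p ^ (t i : ℕ))
    (u : Finset (Fin m)) : mul (var (Sum.inl i)) (pd (Sum.inl i) (mono α u : O F p t)) =
      (α i : F) • mono α u := by
  rw [pd_inl_mono hα]
  split_ifs with h
  · simp [h]
  · rw [var, mul_mono, if_pos (Finset.disjoint_empty_left _), Finset.prod_eq_single i]
    · have h1 : (Pi.single i 1 + (α - Pi.single i 1) : Fin m → ℕ) = α := by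
        ext j
        by_cases hj : j = i
        · subst hj; simp; omega
        · simp [hj]
      rw [h1]
      simp [inv, Nat.add_sub_cancel' (Nat.one_le_iff_ne_zero.2 h)]
    · intro j _ hj
      simp [hj]
    · simp

theorem mul_var_inr_pd (i : Fin m) (α : Fin m → ℕ) (u : Finset (Fin m)) :
    mul (var (Sum.inr i)) (pd (Sum.inr i) (mono α u : O F p t)) =
      if i ∈ u then mono α u else 0 := by
  rw [pd_inr_mono]
  split_ifs with h
  · rw [map_smul, var, mul_mono, if_pos (by simp), inv_singleton_left, Finset.filter_erase,
      Finset.erase_eq_of_notMem (by simp), smul_smul]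
    have : ({i} ∪ u.erase i : Finset (Fin m)) = u := by
      rw [← Finset.insert_eq, Finset.insert_erase h]
    rw [this, ← mul_assoc, ← mul_pow]
    simp
  · simp

/-! ### Even derivations compatible with the odd Poisson bracket -/

/-- The even derivations of `O(m, m; t)` that are derivations of the odd bracket
`(a, b) ↦ T a b`. -/
structure IsPoissonDerivation (E : Module.End F (O F p t)) : Prop where
  even : E ∈ homog F 0
  leibniz : ∀ f g, E (mul f g) = mul (E f) g + mul f (E g)
  apply_T : ∀ f g, E (T f g) = T (E f) g + T f (E g)

namespace IsPoissonDerivation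

variable {E : Module.End F (O F p t)}

theorem sub {E' : Module.End F (O F p t)} (h : IsPoissonDerivation E)
    (h' : IsPoissonDerivation E') : IsPoissonDerivation (E - E') where
  even := Submodule.sub_mem _ h.even h'.even
  leibniz f g := by
    simp only [LinearMap.sub_apply, h.leibniz, h'.leibniz, map_sub]
    abel
  apply_T f g := by
    simp only [LinearMap.sub_apply, h.apply_T, h'.apply_T, map_sub]
    abel

theorem apply_one (h : IsPoissonDerivation E) : E (mono 0 ∅) = 0 := by
  have := h.leibniz (mono 0 ∅) (mono 0 ∅)
  rwa [mul_one', mul_one', one_mul', left_eq_add] at this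

theorem apply_mem_homog (h : IsPoissonDerivation E) {i : ZMod 2} {f : O F p t}
    (hf : f ∈ homog F i) : E f ∈ homog F i := by
  simpa using apply_mem h.even hf

theorem commutator_iterate {M : O F p t →ₗ[F] Module.End F (O F p t)}
    (h : ∀ f g, E (M f g) = M (E f) g + M f (E g)) (f : O F p t) (n : ℕ) :
    (fun z => E * z - z * E)^[n] (M f) = M ((E ^ n) f) := by
  induction n with
  | zero => rfl
  | succ n ih =>
    rw [Function.iterate_succ_apply', ih, pow_succ', Module.End.mul_apply]
    refine LinearMap.ext fun g => ?_
    simp [h]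

variable [Fact p.Prime]

theorem of_T [CharP F p] {a : O F p t} (ha : a ∈ homog F 1) : IsPoissonDerivation (T a) where
  even := T_mem_homog_zero ha
  leibniz f g := by
    conv_lhs => rw [← sum_proj (F := F) f]
    conv_rhs => rw [← sum_proj (F := F) f]
    simp only [map_sum, LinearMap.sum_apply, ← Finset.sum_add_distrib]
    refine Finset.sum_congr rfl fun i _ => ?_
    rw [T_eq_op ha, op_mul (coef_T_mem ha) (proj_mem i f),
      show (1 : ZMod 2) + 1 = 0 by decide, koszul_zero_left, one_smul]
  apply_T f g := by
    have h := congrArg (fun D => D g) (bracket_T a f)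
    simp only [SuperEnd.bracket_of_even (T_mem_homog_zero ha), LinearMap.sub_apply,
      Module.End.mul_apply] at h
    rw [← h]
    abel

theorem pow_prime [CharP F p] (h : IsPoissonDerivation E) : IsPoissonDerivation (E ^ p) := by
  have key : ∀ M : O F p t →ₗ[F] Module.End F (O F p t),
      (∀ f g, E (M f g) = M (E f) g + M f (E g)) → ∀ f g,
      (E ^ p) (M f g) = M ((E ^ p) f) g + M f ((E ^ p) g) := by
    intro M hM f g
    rw [← commutator_iterate hM, commutator_iterate_prime (F := F)]
    simp
  exact ⟨SuperEnd.pow_mem h.even p, key _ h.leibniz, key _ h.apply_T⟩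

/-- The value `f = E(x_{i'})` is odd, and `∂_{j'} f = 0` for all `j`: the operator `T(x_{i'})` maps
`x_j` to a constant. -/
theorem apply_inr_var (h : IsPoissonDerivation E) (hE : ∀ j, E (var (Sum.inl j)) = 0)
    (i : Fin m) : E (var (Sum.inr i)) = 0 := by
  have hodd : E (var (Sum.inr i)) ∈ homog F 1 := h.apply_mem_homog (parity_var (Sum.inr i))
  refine eq_zero_of_pd_inr hodd fun j => ?_
  have h1 := h.apply_T (var (Sum.inr i)) (var (Sum.inl j))
  rw [hE, map_zero, add_zero, T_var_inl hodd, T_inr_var, LinearMap.neg_apply, pd_var] at h1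
  refine koszul_smul_eq_zero (h1.symm.trans ?_)
  split_ifs
  · rw [map_neg, h.apply_one, neg_zero]
  · simp

/-- For `t = (1, …, 1)` the algebra `O(m, m; t)` is generated by the variables. -/
theorem eq_zero [CharP F p] (ht : ∀ i, t i = 1) (h : IsPoissonDerivation E)
    (hE : ∀ j, E (var (Sum.inl j)) = 0) : E = 0 := by
  have hmono : ∀ (n : ℕ) (α : Fin m → ℕ) (u : Finset (Fin m)), ∑ i, α i + u.card = n →
      (∀ i, α i < p ^ (t i : ℕ)) → E (mono α u) = 0 := by
    intro n
    induction n with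
    | zero =>
      intro α u hn _
      have hu : u = ∅ := Finset.card_eq_zero.1 (by omega)
      have hα : α = 0 := by
        ext i
        exact (Finset.sum_eq_zero_iff.1 (by omega : ∑ i, α i = 0)) i (Finset.mem_univ i)
      rw [hu, hα, h.apply_one]
    | succ n ih =>
      intro α u hn hlt
      by_cases hu : ∃ i, i ∈ u
      · obtain ⟨i, hi⟩ := hu
        have h1 := mul_var_inr_pd (F := F) (p := p) (t := t) i α u
        rw [if_pos hi] at h1
        have h2 := Finset.card_erase_add_one hi
        rw [← h1, h.leibniz, h.apply_inr_var hE, pd_inr_mono, if_pos hi, map_smul,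
          map_smul, ih α (u.erase i) (by omega) hlt]
        simp
      · have hα : ∃ i, α i ≠ 0 := by
          by_contra! hα
          have : u.card = 0 :=
            Finset.card_eq_zero.2 (Finset.eq_empty_of_forall_notMem (by simpa using hu))
          simp [hα, this] at hn
        obtain ⟨i, hi⟩ := hα
        have h1 := congrArg E (mul_var_inl_pd (F := F) i hlt u)
        have h2 : ∑ j, (α - Pi.single i 1 : Fin m → ℕ) j + 1 = ∑ j, α j := by
          rw [← Finset.add_sum_erase _ _ (Finset.mem_univ i),
            ← Finset.add_sum_erase _ α (Finset.mem_univ i)]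
          have : ∑ j ∈ Finset.univ.erase i, (α - Pi.single i 1 : Fin m → ℕ) j =
              ∑ j ∈ Finset.univ.erase i, α j :=
            Finset.sum_congr rfl fun j hj => by simp [Finset.ne_of_mem_erase hj]
          rw [this]
          simp only [Pi.sub_apply, Pi.single_eq_same]
          omega
        rw [h.leibniz, hE, pd_inl_mono hlt, if_neg hi, ih (α - Pi.single i 1) u (by omega)
          (fun j => lt_of_le_of_lt (Nat.sub_le _ _) (hlt j)), map_smul] at h1
        have h3 : (α i : F) ≠ 0 := by
          rw [Ne, CharP.cast_eq_zero_iff F p]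
          have := hlt i
          rw [ht, PNat.one_coe, pow_one] at this
          exact fun hd => absurd (Nat.le_of_dvd (by omega) hd) (by omega)
        simpa [h3] using h1.symm
  refine LinearMap.ext fun f => ?_
  induction f using mono_induction with
  | h0 => simp
  | hadd a b ha hb => rw [map_add, ha, hb]; simp
  | hm c α hα u => rw [map_smul, hmono _ α u rfl hα]; simp

end IsPoissonDerivation

end OddHam

namespace OddHam

open SuperSpace LieSuperalgebra

variable {F : Type*} [Field F] {p m : ℕ} {t : Fin m → ℕ+}

/-! ### Elements of weight zero and toral elements -/

theorem weight_eq_zero {α : Fin m → ℕ} {u : Finset (Fin m)} (h : weight α u = 0) (i : Fin m) :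
    α i = if i ∈ u then 1 else 0 := by
  have := congrFun h i
  simp only [weight, Pi.zero_apply] at this
  split_ifs at this ⊢ <;> omega

theorem mul_commute {f g : O F p t} (hf : f ∈ homog F 0) (hg : g ∈ homog F 0) :
    Commute (mul f) (mul g) := by
  refine LinearMap.ext fun h => ?_
  rw [Module.End.mul_apply, Module.End.mul_apply, ← mul_assoc', ← mul_assoc', mul_comm' hf hg,
    koszul_zero_left, one_smul]

theorem pow_apply_eq_of_commute {R M : Type*} [Semiring R] [AddCommMonoid M] [Module R M]
    {D E : Module.End R M} (h : Commute D E) {v : M} (hv : D v = E v) (n : ℕ) :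
    (D ^ n) v = (E ^ n) v := by
  induction n with
  | zero => rfl
  | succ n ih =>
    rw [pow_succ, Module.End.mul_apply, hv, ← Module.End.mul_apply, (h.pow_left n).eq,
      Module.End.mul_apply, ih, ← Module.End.mul_apply, ← pow_succ']

theorem mono_toral_mem (k : Fin m) : (mono (Pi.single k 1) {k} : O F p t) ∈ homog F 1 := by
  simpa using mono_mem (F := F) (p := p) (t := t) (Pi.single k 1) {k}

theorem T_toral_var [Fact p.Prime] (k j : Fin m) :
    T (mono (Pi.single k 1) {k} : O F p t) (var (Sum.inl j)) =
    if k = j then -var (Sum.inl j) else 0 := by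
  rw [T_var_inl (mono_toral_mem k), pd_inr_mono, koszul_one_one]
  by_cases h : k = j
  · subst h
    simp [var, Finset.filter_singleton]
  · simp [h, Ne.symm h]

/-! ### Sufficiency: elements of nonzero weight -/

theorem T_pow_apply_mem_wtSpace {γ δ : Fin m → ℤ} {i : ZMod 2} {a f : O F p t}
    (hi : a ∈ homog F i) (ha : a ∈ wtSpace F p t γ) (hf : f ∈ wtSpace F p t δ) (n : ℕ) :
    (T a ^ n) f ∈ wtSpace F p t (n • γ + δ) := by
  induction n with
  | zero => simpa using hf
  | succ n ih =>
    rw [pow_succ', Module.End.mul_apply, succ_nsmul', add_assoc]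
    exact T_apply_mem_wtSpace hi ha ih

variable [Fact p.Prime] [CharP F p]

/-- `T a ^ p` shifts weights by `p γ`, which moves the weights of the variables `x_j` out of the
range `[-1, p - 1]` of weights of `O(m, m; 1)`; it is then determined to be zero by its values on
these variables. -/
theorem T_pow_prime_eq_zero (hp2 : p ≠ 2) (ht : ∀ i, t i = 1) {γ : Fin m → ℤ} (hγ : γ ≠ 0)
    {a : O F p t} (ha : a ∈ homog F 1) (hw : a ∈ wtSpace F p t γ) : T a ^ p = 0 := by
  have hp := (Fact.out : p.Prime).two_le
  obtain ⟨i, hi⟩ := Function.ne_iff.1 hγ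
  refine (IsPoissonDerivation.of_T ha).pow_prime.eq_zero ht fun j => ?_
  have hj : (var (Sum.inl j) : O F p t) ∈ wtSpace F p t (weight (Pi.single j 1) ∅) :=
    mono_mem_wtSpace _ _
  refine eq_zero_of_mem_wtSpace (T_pow_apply_mem_wtSpace ha hw hj p) i ?_
  rw [ht, PNat.one_coe, pow_one]
  have h0 : (weight (Pi.single j 1) ∅ : Fin m → ℤ) i = 0 ∨
      (weight (Pi.single j 1) ∅ : Fin m → ℤ) i = 1 := by
    by_cases h : i = j
    · subst h; simp [weight]
    · simp [weight, h]
  have e : (p • γ) i = p * γ i := by simp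
  rw [Pi.add_apply, e]
  rcases lt_or_gt_of_ne hi with h | h
  · left
    have : (p : ℤ) * γ i ≤ p * (-1) := by
      apply mul_le_mul_of_nonneg_left _ (by omega)
      simp only [Pi.zero_apply] at h
      omega
    omega
  · right
    have : (p : ℤ) * 1 ≤ p * γ i := by
      apply mul_le_mul_of_nonneg_left _ (by omega)
      simp only [Pi.zero_apply] at h
      omega
    omega

/-! ### Sufficiency: elements of weight zero -/

/-- On weight zero elements `T a` acts trivially, since `T a (x_i x_{i'})` is, up to sign, the
`i`-th weight of `a` times `a`. -/
theorem T_apply_eq_zero_of_weight_zero {a f : O F p t} (ha : a ∈ homog F 1)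
    (hw : a ∈ wtSpace F p t 0) (hf : f ∈ wtSpace F p t 0) : T a f = 0 := by
  have hD := IsPoissonDerivation.of_T ha
  have hy : ∀ i, T a (mul (var (Sum.inl i)) (var (Sum.inr i))) = 0 := by
    intro i
    have h1 : pd (Sum.inr i) a ∈ homog F 0 := pd_apply_mem ha (Sum.inr i)
    rw [hD.leibniz, T_var_inl ha, T_var_inr ha, koszul_one_one, neg_one_smul, map_neg,
      LinearMap.neg_apply, mul_comm' h1 (parity_var (Sum.inr i)), koszul_zero_left, one_smul,
      neg_add_eq_zero]
    refine wtSpace_induction (P := fun a => mul (var (Sum.inr i)) (pd (Sum.inr i) a) =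
      mul (var (Sum.inl i)) (pd (Sum.inl i) a)) (by simp)
      (fun a b ha hb => by simp only [map_add, ha, hb])
      (fun c a ha => by simp only [map_smul, ha]) ?_ hw
    intro α hα u h
    rw [mul_var_inr_pd, mul_var_inl_pd i hα, weight_eq_zero h]
    split_ifs <;> simp
  have hmono : ∀ (n : ℕ) (α : Fin m → ℕ) (u : Finset (Fin m)), u.card = n →
      (∀ i, α i < p ^ (t i : ℕ)) → weight α u = 0 → T a (mono α u) = 0 := by
    intro n
    induction n with
    | zero =>
      intro α u hn hlt h
      rw [Finset.card_eq_zero] at hn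
      subst hn
      have hα : α = 0 := by ext i; simpa using weight_eq_zero h i
      rw [hα, hD.apply_one]
    | succ n ih =>
      intro α u hn hlt h
      obtain ⟨i, hi⟩ : u.Nonempty := Finset.card_pos.1 (by omega)
      have h1 : α i = 1 := by simpa [hi] using weight_eq_zero h i
      have e := mul_var_inl_pd (F := F) i hlt u
      have hlt' : ∀ j, (α - Pi.single i 1 : Fin m → ℕ) j < p ^ (t j : ℕ) := fun j =>
        lt_of_le_of_lt (Nat.sub_le _ _) (hlt j)
      have e2 := mul_var_inr_pd (F := F) (p := p) (t := t) i (α - Pi.single i 1) u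
      have h2 := Finset.card_erase_add_one hi
      rw [h1, Nat.cast_one, one_smul, pd_inl_mono hlt, if_neg (by omega)] at e
      rw [if_pos hi] at e2
      rw [← e, ← e2, ← mul_assoc', hD.leibniz, hy, pd_inr_mono, if_pos hi, map_smul (T a),
        ih _ (u.erase i) (by omega) hlt']
      · simp
      · rw [weight_erase _ hi, weight_sub_single (by omega), h, zero_add, ← Pi.single_add]
        simp
  exact wtSpace_induction (P := fun f => T a f = 0) (by simp)
    (fun a b ha hb => by rw [map_add, ha, hb, add_zero])
    (fun c a ha => by rw [map_smul, ha, smul_zero]) (fun α hα u h => hmono _ α u rfl hα h) hf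

variable (F p t) in
/-- The constant coefficient. -/
noncomputable def constCoef : O F p t →ₗ[F] F :=
  coef (⟨0, fun _ => pow_pos (Fact.out : p.Prime).pos _⟩, ∅)

/-- Even elements of weight zero are polynomials in the products `x_i x_{i'}`, whose squares
vanish; so their `p`-th powers are constants. -/
theorem mul_pow_prime {g : O F p t} (hg : g ∈ homog F 0) (hw : g ∈ wtSpace F p t 0) :
    mul g ^ p = (constCoef F p t g ^ p) • (1 : Module.End F (O F p t)) := by
  have hp := (Fact.out : p.Prime).two_le
  have hchar := charP_of_algebra F (Module.End F (O F p t)) p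
  rw [← mem_homog.1 hg]
  refine wtSpace_induction (P := fun g => mul (proj (F := F) 0 g) ^ p =
    (constCoef F p t (proj (F := F) 0 g) ^ p) • (1 : Module.End F (O F p t))) ?_ ?_ ?_ ?_ hw
  · simp [show p ≠ 0 by omega]
  · intro a b ha hb
    rw [map_add, map_add, map_add, add_pow_char_of_commute p
      (mul_commute (proj_mem _ _) (proj_mem _ _)), ha, hb, ← add_smul, add_pow_char]
  · intro c a ha
    rw [map_smul, map_smul, map_smul, smul_pow, ha, smul_smul, smul_eq_mul, mul_pow]
  · intro α hα u h
    rw [proj_mono]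
    split_ifs with hu
    · rw [constCoef, coef_mono _ hα]
      rcases u.eq_empty_or_nonempty with rfl | hne
      · have h0 : α = 0 := by ext i; simpa using weight_eq_zero h i
        have h1 : mul (mono 0 ∅ : O F p t) = 1 := LinearMap.ext one_mul'
        simp [h0, h1]
      · have hsq : mul (mono α u : O F p t) ^ 2 = 0 := by
          refine LinearMap.ext fun f => ?_
          rw [sq, Module.End.mul_apply, ← mul_assoc', mul_mono, if_neg]
          · simp
          · rw [disjoint_self]; exact hne.ne_empty
        rw [pow_eq_zero_of_le hp hsq, if_neg (by simp [hne.ne_empty])]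
        simp [show p ≠ 0 by omega]
    · simp [show p ≠ 0 by omega]

/-- With `g = ∂_j ∂_{j'} a` one has `T a x_j = -g x_j`, and `T a` commutes with multiplication by
the weight zero element `g`. -/
theorem T_pow_prime_apply_var {a : O F p t} (ha : a ∈ homog F 1) (hw : a ∈ wtSpace F p t 0)
    (j : Fin m) : (T a ^ p) (var (Sum.inl j)) =
      (-constCoef F p t (pd (Sum.inl j) (pd (Sum.inr j) a))) ^ p • var (Sum.inl j) := by
  set g := pd (Sum.inl j) (pd (Sum.inr j) a) with hg
  have hg0 : g ∈ homog F 0 := pd_apply_mem (pd_apply_mem ha (Sum.inr j)) (Sum.inl j)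
  have hgw : g ∈ wtSpace F p t 0 := by
    have := pd_mem_wtSpace (pd_mem_wtSpace hw (Sum.inr j)) (Sum.inl j)
    rwa [add_assoc, add_comm (pdWeight _), ← Sum.swap_inr, pdWeight_swap, add_zero] at this
  have hcomm : Commute (T a) (mul (-g)) := by
    refine LinearMap.ext fun f => ?_
    rw [Module.End.mul_apply, Module.End.mul_apply, (IsPoissonDerivation.of_T ha).leibniz,
      T_apply_eq_zero_of_weight_zero ha hw (Submodule.neg_mem _ hgw)]
    simp
  have hvar : T a (var (Sum.inl j)) = mul (-g) (var (Sum.inl j)) := by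
    rw [T_var_inl ha, koszul_one_one, neg_one_smul, map_neg, LinearMap.neg_apply,
      mul_comm' hg0 (parity_var (Sum.inl j)), koszul_zero_left, one_smul, neg_inj]
    refine (wtSpace_induction (P := fun a => mul (var (Sum.inl j))
      (pd (Sum.inl j) (pd (Sum.inr j) a)) = pd (Sum.inr j) a) (by simp)
      (fun a b ha hb => by simp only [map_add, ha, hb])
      (fun c a ha => by simp only [map_smul, ha]) ?_ hw).symm
    intro α hα u h
    rw [pd_inr_mono]
    split_ifs with hj
    · rw [map_smul, map_smul, mul_var_inl_pd j hα, weight_eq_zero h, if_pos hj, Nat.cast_one,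
        one_smul]
    · simp
  rw [pow_apply_eq_of_commute hcomm hvar,
    mul_pow_prime (Submodule.neg_mem _ hg0) (Submodule.neg_mem _ hgw), map_neg]
  rfl

theorem T_sum_toral_mem_SHO2 (hm : 3 ≤ m) {e : Fin m → F} (he : ∑ k, e k = 0) :
    T (∑ k, e k • mono (Pi.single k 1) {k} : O F p t) ∈ (SHO2 F p t).carrier := by
  have h : (∑ k, e k • mono (Pi.single k 1) {k} : O F p t) =
      ∑ k, e k • (mono (Pi.single k 1) {k} - mono (Pi.single ⟨0, by omega⟩ 1) {⟨0, by omega⟩}) := by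
    simp only [smul_sub, Finset.sum_sub_distrib, ← Finset.sum_smul, he, zero_smul, sub_zero]
  rw [h, map_sum]
  refine Submodule.sum_mem _ fun k _ => ?_
  rw [map_smul]
  exact Submodule.smul_mem _ _ (T_toral_mem_SHO2 hm _ k)

/-- The `p`-th power of a weight zero element is the toral element determined by its linear part;
the divergence condition is preserved because `e ↦ e ^ p` is additive. -/
theorem T_pow_prime_mem_of_weight_zero (ht : ∀ i, t i = 1) (hm : 3 ≤ m) {a : O F p t}
    (ha : a ∈ homog F 1) (hw : a ∈ wtSpace F p t 0) (hlap : lap a = 0) :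
    T a ^ p ∈ (SHO2 F p t).carrier := by
  set e : Fin m → F := fun k =>
    -(-constCoef F p t (pd (Sum.inl k) (pd (Sum.inr k) a))) ^ p with he
  have hsum : ∑ k, e k = 0 := by
    simp only [he]
    rw [Finset.sum_neg_distrib, ← sum_pow_char p, Finset.sum_neg_distrib, ← map_sum, ← lap_apply,
      hlap, map_zero, neg_zero, zero_pow (Fact.out : p.Prime).ne_zero, neg_zero]
  set b : O F p t := ∑ k, e k • mono (Pi.single k 1) {k} with hb
  have hb1 : b ∈ homog F 1 :=
    Submodule.sum_mem _ fun k _ => Submodule.smul_mem _ _ (mono_toral_mem k)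
  have h : T a ^ p - T b = 0 := by
    refine ((IsPoissonDerivation.of_T ha).pow_prime.sub (IsPoissonDerivation.of_T hb1)).eq_zero ht
      fun j => ?_
    have hbj : T b (var (Sum.inl j)) = -(e j • var (Sum.inl j)) := by
      rw [hb, map_sum, LinearMap.sum_apply]
      simp [T_toral_var]
    rw [LinearMap.sub_apply, hbj, T_pow_prime_apply_var ha hw, he, neg_smul, neg_neg, sub_self]
  rw [sub_eq_zero.1 h]
  exact T_sum_toral_mem_SHO2 hm hsum

theorem isRestricted_SHO2 (hp : p ≠ 2) (hm : 3 ≤ m) (ht : ∀ i, t i = 1) :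
    IsRestricted F (SHO2 F p t).carrier p := by
  refine LieSubsuperalgebra.isRestricted_of_pow_mem p _ fun x hx hx0 => ?_
  refine LieSubsuperalgebra.pow_mem_of_span p _ (SHO2_le_span_homogElements hp)
    (fun x hx => hx.1) ?_ hx hx0
  rintro _ ⟨hT, γ, i, a, hw, ha, rfl⟩
  rw [proj_T]
  have hi : i = 0 ∨ i = 1 := by clear ha; revert i; decide
  rcases hi with rfl | rfl
  · rw [proj_of_mem ha, if_neg (by decide), map_zero, zero_pow (Fact.out : p.Prime).ne_zero]
    exact Submodule.zero_mem _
  · rw [proj_of_mem ha, if_pos (by decide)]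
    by_cases hγ : γ = 0
    · subst hγ
      exact T_pow_prime_mem_of_weight_zero ht hm ha hw (lap_eq_zero hp ha (SHO2_le_SHO hT))
    · rw [T_pow_prime_eq_zero hp ht hγ ha hw]
      exact Submodule.zero_mem _

end OddHam

theorem theorem2p2 (F : Type*) [Field F] (p : ℕ) [Fact p.Prime] [CharP F p] (hp : 3 < p)
    (m : ℕ) (hm : 3 ≤ m) (t : Fin m → ℕ+) :
    LieSuperalgebra.IsRestricted F (OddHam.SHO2 F p t).carrier p ↔ ∀ i, t i = 1 :=
  ⟨OddHam.eq_one_of_isRestricted (by omega) hm, OddHam.isRestricted_SHO2 (by omega) hm⟩
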